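/- Let $d\ge 1$, let $\mathcal X=\{0,1\}^{\mathbb Z^d}$ with its product $\sigma$-algebra, and let $\mathbb P$ be the product measure on $\mathcal X$ with parameter $1/2$ (independent fair coin-flips at the sites of $\mathbb Z^d$). A matching on $\gamma\in\mathcal X$ is a bijection $\phi:\mathbb Z^d\to\mathbb Z^d$ with $\phi\circ\phi=\mathrm{id}$ that maps every site $x$ with $\gamma(x)=1$ to a site $y$ with $\gamma(y)=0$ and vice versa. A matching rule is a measurable map $\Phi:\mathcal X\times\mathbb Z^d\to\mathbb Z^d$ such that $\Phi(\gamma,\cdot)$ is a matching on $\gamma$ for $\mathbb P$-almost every $\gamma$. It is translation-equivariant if, for $\mathbb P$-almost every $\gamma$, one has $\Phi(\theta^z\gamma,x+z)=\Phi(\gamma,x)+z$ for all $x,z\in\mathbb Z^d$, where $(\theta^z\gamma)(x)=\gamma(x-z)$. Let $Z_\Phi(\gamma)=\|\Phi(\gamma,0)\|_\infty$ be the $\ell^\infty$ distance from the origin to its partner, and let $\beta(d)=\frac{2d}{d+4}$. **Theorem.** For every $d\ge 1$ there exist a translation-equivariant matching rule $\Phi$ and a constant $c=c(d)<\infty$ such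 that for all real $r\ge 2$ $$\mathbb P(Z_\Phi>r)\le c\,(\log r)^{4}\,r^{-\beta(d)} .$$ Moreover, if $d\ge 2$, then this rule satisfies $\mathbb E\, Z_\Phi^{2/3-\varepsilon}<\infty$ for every $\varepsilon>0$. -/

import Mathlib

open MeasureTheory

noncomputable section

namespace CoinMatching

/-- The sites of the lattice `ℤ^d`. The norm that Mathlib puts on this type is the `ℓ^∞` norm. -/
abbrev Site (d : ℕ) : Type := Fin d → ℤ

/-- Configurations of coin-flips, elements of `{0,1}^{ℤ^d}`, with the product σ-algebra;
`true` stands for `1` (heads) and `false` for `0` (tails). -/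
abbrev Config (d : ℕ) : Type := Site d → Bool

/-- The law of independent fair coin-flips: the product measure with parameter `1/2`. -/
def coinMeasure (d : ℕ) : Measure (Config d) :=
  Measure.infinitePi fun _ : Site d => (PMF.uniformOfFintype Bool).toMeasure

/-- The translation `θ^z` on configurations, `(θ^z γ)(x) = γ (x - z)`. -/
def translate {d : ℕ} (z : Site d) (γ : Config d) : Config d := fun x => γ (x - z)

/-- `φ` is a (perfect) matching of heads to tails on `γ`: a bijection that is its own inverse,
and maps ones to zeros and zeros to ones. -/
structure IsMatching {d : ℕ} (γ : Config d) (φ : Site d → Site d) : Prop where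
  bijective : Function.Bijective φ
  map_one : ∀ x, γ x = true → γ (φ x) = false
  map_zero : ∀ x, γ x = false → γ (φ x) = true
  involutive : ∀ x, φ (φ x) = x

/-- `Φ` is a matching rule: a measurable map `{0,1}^{ℤ^d} × ℤ^d → ℤ^d` such that `Φ(γ, ·)` is a
matching on `γ` for almost all `γ`. -/
structure IsMatchingRule {d : ℕ} (Φ : Config d × Site d → Site d) : Prop where
  measurable : Measurable Φ
  ae_isMatching : ∀ᵐ γ ∂(coinMeasure d), IsMatching γ fun x => Φ (γ, x)

/-- `Φ` commutes with translations: for almost all `γ`, the partner of the translate of `x` in the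
translate of `γ` is the translate of the partner of `x` in `γ`. -/
def IsTranslationEquivariant {d : ℕ} (Φ : Config d × Site d → Site d) : Prop :=
  ∀ᵐ γ ∂(coinMeasure d), ∀ z x : Site d, Φ (translate z γ, x + z) = Φ (γ, x) + z

/-- `Z_Φ(γ)`, the `ℓ^∞` distance from the origin to its partner. -/
def partnerDist {d : ℕ} (Φ : Config d × Site d → Site d) (γ : Config d) : ℝ := ‖Φ (γ, 0)‖

end CoinMatching

end

noncomputable section

namespace CoinMatching

/-! ### Functions of finitely many coins. -/

variable {d : ℕ}

/-! The configuration must supply both a translation-equivariant partition of the lattice and coins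
that remain random given this partition. Seams achieve this. Fix a direction `i`. Whether a cut
between two neighbours in this direction is a seam depends on three comparisons of nearby coins,
none of which crosses the cut. Exchanging heads and tails on a set whose boundary in direction `i`
consists of seams therefore preserves the whole set of seams (`isSeam_flip`). So the runs between
successive seams can be reversed one by one without changing the seams or the law.

The nested cells are defined from seams alone (`root_congr`). For `k ≥ 1`, cells of level `k` have
diameter of order `k ^ 2 * 8 ^ k`, and the origin is the root of a nonempty cell with probability at
most `2 * 8 ^ (-d k)` (`measure_exists_root_le`). At each level as many of the remaining sites as
possible are matched inside their cells, so the number of unmatched sites in a cell is the absolute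
value of its excess of heads (`sum_free_eq_abs_excess`).

In the second moment of the excess, two sites contribute only through the event that no seam lies
between them on a common line. Mass transport then bounds this moment by twice the mean run length,
uniformly in `k` (`integral_excess_sq_le`). Combined with the rarity of roots as in Cauchy–Schwarz,
this makes the density of unmatched sites `O(8 ^ (-d k / 2))` (`measure_free_le`). Taking `8 ^ k`
near `r ^ (4 / (d + 4))` gives the exponent `2 d / (d + 4)`; the spare power of `r` absorbs `k ^ 2`,
so no logarithm is needed. The moments follow from the tail. -/

instance : IsProbabilityMeasure (coinMeasure d) := by
  unfold coinMeasure; infer_instance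

/-- A function of the configuration that is determined by finitely many coin-flips. -/
def IsLocal {α : Type*} (f : Config d → α) : Prop :=
  ∃ S : Finset (Site d), DependsOn f (S : Set (Site d))

theorem DependsOn.comp_left {α β : Type*} {f : Config d → α} {S : Set (Site d)}
    (hf : DependsOn f S) (g : α → β) : DependsOn (fun γ => g (f γ)) S :=
  fun _ _ h => congrArg g (hf h)

theorem exists_eq_comp_restrict {α : Type*} {f : Config d → α} {S : Finset (Site d)}
    (hf : DependsOn f (S : Set (Site d))) :
    ∃ g : (S → Bool) → α, ∀ γ, f γ = g fun z => γ z := by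
  classical
  refine ⟨fun η => f fun z => if h : z ∈ S then η ⟨z, h⟩ else false, fun γ => hf fun z hz => ?_⟩
  have : z ∈ S := hz
  simp [this]

theorem IsLocal.measurable {α : Type*} [MeasurableSpace α] {f : Config d → α} (hf : IsLocal f) :
    Measurable f := by
  obtain ⟨S, hS⟩ := hf
  obtain ⟨g, hg⟩ := exists_eq_comp_restrict hS
  rw [show f = g ∘ fun γ (z : S) => γ z from funext hg]
  exact (measurable_of_finite g).comp (by fun_prop)

theorem IsLocal.measurableSet {p : Config d → Prop} (hp : IsLocal p) : MeasurableSet {γ | p γ} :=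
  measurableSet_setOfPred.2 hp.measurable

theorem IsLocal.comp_left {α β : Type*} {f : Config d → α} (hf : IsLocal f) (g : α → β) :
    IsLocal fun γ => g (f γ) :=
  let ⟨S, hS⟩ := hf
  ⟨S, DependsOn.comp_left hS g⟩

theorem isLocal_const {α : Type*} (a : α) : IsLocal fun _ : Config d => a := ⟨∅, fun _ _ _ => rfl⟩

theorem isLocal_eval (z : Site d) : IsLocal fun γ : Config d => γ z :=
  ⟨{z}, fun _ _ h => h z (by simp)⟩

theorem IsLocal.comp₂ {α β δ : Type*} {f : Config d → α} {g : Config d → β} (hf : IsLocal f)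
    (hg : IsLocal g) (h : α → β → δ) : IsLocal fun γ => h (f γ) (g γ) := by
  classical
  obtain ⟨S, hS⟩ := hf
  obtain ⟨T, hT⟩ := hg
  refine ⟨S ∪ T, fun γ γ' hγ => ?_⟩
  have h1 : f γ = f γ' := hS fun z hz => hγ z (by simp_all)
  have h2 : g γ = g γ' := hT fun z hz => hγ z (by simp_all)
  simp only [h1, h2]

theorem IsLocal.pi {ι α : Type*} {f : ι → Config d → α} (s : Finset ι)
    (hf : ∀ i ∈ s, IsLocal (f i)) : IsLocal fun γ (i : s) => f i γ := by
  classical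
  choose! S hS using hf
  refine ⟨s.biUnion S, fun γ γ' hγ => funext fun i => hS i i.2 fun z hz => hγ z ?_⟩
  simp only [Finset.coe_biUnion, Set.mem_iUnion]
  exact ⟨i, i.2, hz⟩

/-- A function of a local function and of finitely many members of a family of local functions is
local. -/
theorem IsLocal.of_agree {ι α β δ : Type*} {f : ι → Config d → α} {g : Config d → β}
    {h : Config d → δ} (hg : IsLocal g) (s : β → Finset ι) (t : Finset ι)
    (hst : ∀ γ, s (g γ) ⊆ t) (hf : ∀ i ∈ t, IsLocal (f i))
    (hh : ∀ γ γ', g γ = g γ' → (∀ i ∈ s (g γ), f i γ = f i γ') → h γ = h γ') : IsLocal h := by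
  obtain ⟨S, hS⟩ := hg.comp₂ (IsLocal.pi t hf) Prod.mk
  refine ⟨S, fun γ γ' hγ => ?_⟩
  have h1 := hS hγ
  simp only [Prod.mk.injEq] at h1
  exact hh γ γ' h1.1 fun i hi => congrFun h1.2 ⟨i, hst γ hi⟩

theorem isLocal_forall_mem {ι : Type*} {p : ι → Config d → Prop} (s : Finset ι)
    (hp : ∀ i ∈ s, IsLocal (p i)) : IsLocal fun γ => ∀ i ∈ s, p i γ := by
  simpa using (IsLocal.pi s hp).comp_left fun η : s → Prop => ∀ i, η i

/-! ### Translations and flips -/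

theorem measurePreserving_translate (z : Site d) :
    MeasurePreserving (translate z) (coinMeasure d) (coinMeasure d) := by
  refine ⟨measurable_pi_lambda _ fun x => measurable_pi_apply _, ?_⟩
  have := Measure.map_infinitePi_infinitePi_of_inj
    (P := fun _ : Site d => (PMF.uniformOfFintype Bool).toMeasure) (f := fun x : Site d => x - z)
    (sub_left_injective)
  exact this

theorem measure_translate {p q : Config d → Prop} (z : Site d) (hp : MeasurableSet {γ | p γ})
    (h : ∀ γ, p (translate z γ) ↔ q γ) :
    coinMeasure d {γ | p γ} = coinMeasure d {γ | q γ} := by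
  rw [← (measurePreserving_translate z).measure_preimage hp.nullMeasurableSet]
  exact congrArg _ (Set.ext h)

/-- Exchange heads and tails on `A`. -/
def flip (A : Set (Site d)) (γ : Config d) : Config d := fun x =>
  open Classical in if x ∈ A then !γ x else γ x

theorem flip_of_mem {A : Set (Site d)} {x : Site d} (h : x ∈ A) (γ : Config d) :
    flip A γ x = !γ x := by simp [flip, h]

theorem flip_of_notMem {A : Set (Site d)} {x : Site d} (h : x ∉ A) (γ : Config d) :
    flip A γ x = γ x := by simp [flip, h]

theorem flip_flip (A : Set (Site d)) (γ : Config d) : flip A (flip A γ) = γ := by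
  funext x
  by_cases h : x ∈ A <;> simp [flip, h]

theorem map_not_uniform :
    (PMF.uniformOfFintype Bool).toMeasure.map not = (PMF.uniformOfFintype Bool).toMeasure := by
  rw [PMF.toMeasure_map _ _ (measurable_of_finite _)]
  congr 1
  ext b
  cases b <;> simp [PMF.map_apply]

theorem measurePreserving_flip (A : Set (Site d)) :
    MeasurePreserving (flip A) (coinMeasure d) (coinMeasure d) := by
  classical
  have hm (x : Site d) : Measurable (if x ∈ A then not else id) := measurable_of_finite _
  have key := Measure.infinitePi_map_pi
    (fun _ : Site d => (PMF.uniformOfFintype Bool).toMeasure) hm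
  have heq : flip A = fun (γ : Config d) x => (if x ∈ A then not else id) (γ x) := by
    funext γ x
    by_cases h : x ∈ A <;> simp [flip, h]
  refine ⟨?_, ?_⟩
  · rw [heq]; exact measurable_pi_lambda _ fun x => (hm x).comp (measurable_pi_apply x)
  · rw [heq, coinMeasure, key]
    congr 1
    funext x
    by_cases h : x ∈ A
    · simp only [h, if_true]; exact map_not_uniform
    · simp only [h, if_false]; exact Measure.map_id

/-! ### Independence -/

theorem measure_inter_of_disjoint {p q : Config d → Prop} {S T : Finset (Site d)}
    (hST : Disjoint S T) (hp : DependsOn p (S : Set (Site d)))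
    (hq : DependsOn q (T : Set (Site d))) :
    coinMeasure d {γ | p γ ∧ q γ} = coinMeasure d {γ | p γ} * coinMeasure d {γ | q γ} := by
  have hind : ProbabilityTheory.iIndepFun (fun z (γ : Config d) => γ z) (coinMeasure d) :=
    ProbabilityTheory.iIndepFun_infinitePi
      (P := fun _ : Site d => (PMF.uniformOfFintype Bool).toMeasure)
      (X := fun _ b => b) (fun _ => measurable_id)
  have h := hind.indepFun_finset S T hST (fun z => measurable_pi_apply z)
  obtain ⟨f, hf⟩ := exists_eq_comp_restrict hp
  obtain ⟨g, hg⟩ := exists_eq_comp_restrict hq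
  have key := h.measure_inter_preimage_eq_mul {η | f η} {η | g η}
    (Set.toFinite _).measurableSet (Set.toFinite _).measurableSet
  have e1 : {γ : Config d | p γ} = (fun γ (z : S) => γ z) ⁻¹' {η | f η} := by
    ext γ; simp [hf]
  have e2 : {γ : Config d | q γ} = (fun γ (z : T) => γ z) ⁻¹' {η | g η} := by
    ext γ; simp [hg]
  rw [Set.ofPred_and, e1, e2]
  exact key

theorem measure_forall_of_pairwiseDisjoint {ι : Type*} {p : ι → Config d → Prop} (s : Finset ι)
    {S : ι → Finset (Site d)} (hS : (s : Set ι).PairwiseDisjoint S)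
    (hp : ∀ i ∈ s, DependsOn (p i) (S i : Set (Site d))) :
    coinMeasure d {γ | ∀ i ∈ s, p i γ} = ∏ i ∈ s, coinMeasure d {γ | p i γ} := by
  classical
  induction s using Finset.induction_on with
  | empty => simp
  | insert a s ha ih =>
    rw [Finset.prod_insert ha, ← ih (hS.subset (by simp)) fun i hi => hp i (by simp [hi])]
    simp only [Finset.forall_mem_insert]
    refine measure_inter_of_disjoint (S := S a) (T := s.biUnion S) ?_ (hp a (by simp)) ?_
    · rw [Finset.disjoint_biUnion_right]
      intro i hi
      exact hS (by simp) (by simp [hi]) (by rintro rfl; exact ha hi)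
    · intro γ γ' h
      have : ∀ i ∈ s, p i γ = p i γ' := fun i hi =>
        hp i (by simp [hi]) fun z hz => h z (by
          simp only [Finset.coe_biUnion, Set.mem_iUnion]; exact ⟨i, hi, hz⟩)
      exact propext (forall₂_congr fun i hi => by rw [this i hi])

/-- An event has conditional probability `1/2` if it is complemented by a flip that keeps the
conditioning event. -/
theorem measure_and_of_flip {p q : Config d → Prop} (A : Set (Site d)) (hp : IsLocal p)
    (hq : IsLocal q) (h1 : ∀ γ, p (flip A γ) ↔ ¬ p γ) (h2 : ∀ γ, q (flip A γ) ↔ q γ) :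
    coinMeasure d {γ | p γ ∧ q γ} = coinMeasure d {γ | q γ} / 2 := by
  have hpq : MeasurableSet {γ | p γ ∧ q γ} := (hp.comp₂ hq And).measurableSet
  have h3 := (measurePreserving_flip A).measure_preimage hpq.nullMeasurableSet
  have h4 : flip A ⁻¹' {γ | p γ ∧ q γ} = {γ | q γ} \ {γ | p γ} := by
    ext γ; simp [h1, h2, and_comm]
  have h5 := measure_inter_add_sdiff (μ := coinMeasure d) {γ | q γ} hp.measurableSet
  rw [← h4, h3, ← Set.ofPred_and] at h5
  simp only [and_comm (a := q _)] at h5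
  rw [← h5, ← two_mul, mul_comm, ENNReal.mul_div_cancel_right (by simp) (by simp)]

/-! ### Seams and markers -/

theorem add_single_add_single (i : Fin d) (z : Site d) (s t : ℤ) :
    z + Pi.single i s + Pi.single i t = z + Pi.single i (s + t) := by
  rw [add_assoc, ← Pi.single_add]

theorem add_single_inj (i : Fin d) (z : Site d) {s t : ℤ} :
    z + Pi.single i s = z + Pi.single i t ↔ s = t := by
  rw [add_right_inj, Pi.single_inj]

/-- There is a seam at `z`, that is between `z` and its neighbour in direction `i`. The condition
does not relate the coins at these two sites. -/
def IsSeam (i : Fin d) (γ : Config d) (z : Site d) : Prop :=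
  γ (z + Pi.single i (-2)) ≠ γ (z + Pi.single i (-1)) ∧
    γ (z + Pi.single i (-1)) = γ (z + Pi.single i 0) ∧
    γ (z + Pi.single i 1) ≠ γ (z + Pi.single i 2)

/-- The segment of the sites `z + t`, where `t ∈ [a, b]` in direction `i`. -/
def segment (i : Fin d) (z : Site d) (a b : ℤ) : Finset (Site d) :=
  (Finset.Icc a b).image fun t => z + Pi.single i t

theorem mem_segment {i : Fin d} {z w : Site d} {a b : ℤ} :
    w ∈ segment i z a b ↔ ∃ t, (a ≤ t ∧ t ≤ b) ∧ z + Pi.single i t = w := by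
  simp [segment]

theorem dependsOn_isSeam (i : Fin d) (z : Site d) :
    DependsOn (fun γ => IsSeam i γ z) (segment i z (-2) 2 : Set (Site d)) := by
  intro γ γ' h
  have h' (t : ℤ) (h1 : -2 ≤ t) (h2 : t ≤ 2) : γ (z + Pi.single i t) = γ' (z + Pi.single i t) :=
    h _ (mem_segment.2 ⟨t, ⟨h1, h2⟩, rfl⟩)
  simp only [IsSeam, h' 0 (by simp) (by simp), h' (-2) (by simp) (by simp),
    h' (-1) (by simp) (by simp), h' 1 (by simp) (by simp), h' 2 (by simp) (by simp)]

theorem isLocal_isSeam (i : Fin d) (z : Site d) : IsLocal fun γ => IsSeam i γ z :=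
  ⟨_, dependsOn_isSeam i z⟩

theorem isSeam_translate (i : Fin d) (γ : Config d) (v z : Site d) :
    IsSeam i (translate v γ) (z + v) ↔ IsSeam i γ z := by
  simp only [IsSeam, translate, add_right_comm z v, add_sub_cancel_right]

/-- Each of the three comparisons is reversed by flipping a single site that the comparisons already
treated do not involve, so each contributes a factor `1/2`. -/
theorem measure_isSeam (i : Fin d) (z : Site d) :
    coinMeasure d {γ | IsSeam i γ z} = 1 / 8 := by
  have hl (s t : Site d) : IsLocal fun γ : Config d => γ s = γ t :=
    (isLocal_eval s).comp₂ (isLocal_eval t) Eq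
  have hl' (s t : Site d) : IsLocal fun γ : Config d => γ s ≠ γ t :=
    (isLocal_eval s).comp₂ (isLocal_eval t) Ne
  have hne (s t : ℤ) (h : s ≠ t) : z + Pi.single i s ∉ ({z + Pi.single i t} : Set (Site d)) := by
    rw [Set.mem_singleton_iff, add_single_inj]; exact h
  have hself (s : ℤ) : z + Pi.single i s ∈ ({z + Pi.single i s} : Set (Site d)) := rfl
  unfold IsSeam
  have h1 : coinMeasure d {γ | γ (z + Pi.single i (-1)) = γ (z + Pi.single i 0)} = 1 / 2 := by
    have := measure_and_of_flip (d := d)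
      (p := fun γ => γ (z + Pi.single i (-1)) = γ (z + Pi.single i 0)) (q := fun _ => True)
      {z + Pi.single i 0} (hl _ _) (isLocal_const _) ?_ (fun _ => Iff.rfl)
    · simpa using this
    · intro γ
      rw [flip_of_mem (hself 0), flip_of_notMem (hne _ _ (by decide))]
      cases γ (z + Pi.single i (-1)) <;> cases γ (z + Pi.single i 0) <;> simp
  have h2 : coinMeasure d {γ | γ (z + Pi.single i 1) ≠ γ (z + Pi.single i 2) ∧
      γ (z + Pi.single i (-1)) = γ (z + Pi.single i 0)} = 1 / 2 / 2 := by
    rw [← h1]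
    refine measure_and_of_flip {z + Pi.single i 2} (hl' _ _) (hl _ _) ?_ ?_ <;> intro γ
    · rw [flip_of_mem (hself 2), flip_of_notMem (hne _ _ (by decide))]
      cases γ (z + Pi.single i 1) <;> cases γ (z + Pi.single i 2) <;> simp
    · rw [flip_of_notMem (hne _ _ (by decide)), flip_of_notMem (hne _ _ (by decide))]
  have h3 : coinMeasure d {γ | γ (z + Pi.single i (-2)) ≠ γ (z + Pi.single i (-1)) ∧
      γ (z + Pi.single i 1) ≠ γ (z + Pi.single i 2) ∧
      γ (z + Pi.single i (-1)) = γ (z + Pi.single i 0)} = 1 / 2 / 2 / 2 := by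
    rw [← h2]
    refine measure_and_of_flip {z + Pi.single i (-2)} (hl' _ _) ((hl' _ _).comp₂ (hl _ _) And)
      ?_ ?_ <;> intro γ
    · rw [flip_of_mem (hself (-2)), flip_of_notMem (hne _ _ (by decide))]
      cases γ (z + Pi.single i (-2)) <;> cases γ (z + Pi.single i (-1)) <;> simp
    · repeat rw [flip_of_notMem (hne _ _ (by decide))]
  have h4 : (1 / 2 / 2 / 2 : ENNReal) = 1 / 8 := by
    rw [one_div, one_div, ENNReal.div_eq_inv_mul, ENNReal.div_eq_inv_mul,
      ← ENNReal.mul_inv (by simp) (by simp), ← ENNReal.mul_inv (by simp) (by simp)]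
    norm_num
  rw [← h4, ← h3]
  exact congrArg _ (Set.ext fun γ => by simp only [Set.mem_ofPred_eq]; tauto)

theorem xor_eq_xor_iff (a b c e : Bool) : ((a ^^ c) = (b ^^ e)) ↔ ((a = b) ↔ (c = e)) := by
  cases a <;> cases b <;> cases c <;> cases e <;> decide

/-- Seams are not affected by a flip whose boundary in direction `i` consists of seams. -/
theorem isSeam_flip {i : Fin d} {γ : Config d} {A : Set (Site d)}
    (hA : ∀ w, (w ∈ A ↔ w + Pi.single i 1 ∈ A) ∨ IsSeam i γ w) (z : Site d) :
    IsSeam i (flip A γ) z ↔ IsSeam i γ z := by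
  have hxor (t : ℤ) : ∃ b : Bool, (b = true ↔ z + Pi.single i t ∈ A) ∧
      flip A γ (z + Pi.single i t) = (b ^^ γ (z + Pi.single i t)) := by
    classical
    refine ⟨decide (z + Pi.single i t ∈ A), by simp, ?_⟩
    by_cases h : z + Pi.single i t ∈ A <;> simp [flip, h]
  choose b hb hflip using hxor
  have hA' (t : ℤ) := hA (z + Pi.single i t)
  simp only [IsSeam, add_single_add_single, ← hb] at hA'
  -- The comparisons at `z` lie across the cuts at offsets `-2`, `-1` and `1`. If one of these cuts
  -- is a seam, the coins next to it make another comparison at `z` fail, and this failure survives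
  -- the flip, since seams are never at distance 1 or 2.
  have h2 := hA' (-2)
  have h1 := hA' (-1)
  have h3 := hA' 1
  simp only [IsSeam, hflip, ne_eq, xor_eq_xor_iff]
  simp only [← Bool.eq_iff_iff, Int.reduceNeg, Int.reduceAdd] at h1 h2 h3
  generalize γ (z + Pi.single i 0) = g0 at *
  tauto

theorem disjoint_segment {i : Fin d} {z w : Site d} {a b : ℤ}
    (h : ∀ s t, a ≤ s → s ≤ b → a ≤ t → t ≤ b → z + Pi.single i s ≠ w + Pi.single i t) :
    Disjoint (segment i z a b) (segment i w a b) := by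
  rw [Finset.disjoint_left]
  intro x hx hx'
  obtain ⟨s, hs, rfl⟩ := mem_segment.1 hx
  obtain ⟨t, ht, h'⟩ := mem_segment.1 hx'
  exact h s t hs.1 hs.2 ht.1 ht.2 h'.symm

theorem disjoint_segment_of_five_mul (i : Fin d) (z : Site d) {j k : ℕ} (h : j ≠ k) :
    Disjoint (segment i (z + Pi.single i (5 * j : ℤ)) (-2) 2)
      (segment i (z + Pi.single i (5 * k : ℤ)) (-2) 2) := by
  refine disjoint_segment fun s t hs hs' ht ht' => ?_
  rw [add_single_add_single, add_single_add_single, Ne, add_single_inj]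
  omega

/-- A marker of level `m` at `z`: seams at `z + 5 j`, `j < m`. -/
def IsMarker (i : Fin d) (m : ℕ) (γ : Config d) (z : Site d) : Prop :=
  ∀ j ∈ Finset.range m, IsSeam i γ (z + Pi.single i (5 * j : ℤ))

theorem isMarker_translate (i : Fin d) (m : ℕ) (γ : Config d) (v z : Site d) :
    IsMarker i m (translate v γ) (z + v) ↔ IsMarker i m γ z := by
  simp only [IsMarker, add_right_comm z v, isSeam_translate]

theorem dependsOn_isMarker (i : Fin d) (m : ℕ) (z : Site d) :
    DependsOn (fun γ => IsMarker i m γ z) (segment i z (-2) (5 * m - 3) : Set (Site d)) := by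
  intro γ γ' h
  refine propext (forall₂_congr fun j hj => ?_)
  rw [Finset.mem_range] at hj
  refine iff_of_eq (dependsOn_isSeam i _ fun x hx => h x ?_)
  obtain ⟨t, ht, rfl⟩ := mem_segment.1 hx
  exact mem_segment.2 ⟨5 * j + t, by omega, (add_single_add_single _ _ _ _).symm⟩

theorem isLocal_isMarker (i : Fin d) (m : ℕ) (z : Site d) : IsLocal fun γ => IsMarker i m γ z :=
  ⟨_, dependsOn_isMarker i m z⟩

theorem measure_isMarker (i : Fin d) (m : ℕ) (z : Site d) :
    coinMeasure d {γ | IsMarker i m γ z} = (1 / 8) ^ m := by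
  unfold IsMarker
  rw [measure_forall_of_pairwiseDisjoint (Finset.range m)
    (fun j _ k _ hjk => disjoint_segment_of_five_mul i z hjk) fun j _ => dependsOn_isSeam i _]
  simp [measure_isSeam]

theorem measure_not {p : Config d → Prop} (hp : IsLocal p) :
    coinMeasure d {γ | ¬ p γ} = 1 - coinMeasure d {γ | p γ} :=
  prob_compl_eq_one_sub hp.measurableSet

/-- None of the first `n` cuts after `x` in direction `i` is a seam. -/
def SeamFree (i : Fin d) (n : ℕ) (γ : Config d) (x : Site d) : Prop :=
  ∀ t ∈ Finset.range n, ¬ IsSeam i γ (x + Pi.single i (t : ℤ))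

theorem isLocal_seamFree (i : Fin d) (n : ℕ) (x : Site d) : IsLocal fun γ => SeamFree i n γ x :=
  isLocal_forall_mem _ fun _ _ => (isLocal_isSeam i _).comp_left Not

theorem seamFree_translate (i : Fin d) (n : ℕ) (γ : Config d) (v x : Site d) :
    SeamFree i n (translate v γ) (x + v) ↔ SeamFree i n γ x := by
  simp only [SeamFree, add_right_comm x v, isSeam_translate]

/-- Every fifth cut is kept: a seam is determined by five consecutive sites, so these events are
independent. -/
theorem measure_seamFree_le (i : Fin d) (n : ℕ) (x : Site d) :
    coinMeasure d {γ | SeamFree i n γ x} ≤ (1 - 1 / 8) ^ (n / 5) := by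
  calc coinMeasure d {γ | SeamFree i n γ x}
      ≤ coinMeasure d {γ | ∀ j ∈ Finset.range (n / 5),
          ¬ IsSeam i γ (x + Pi.single i (5 * j : ℤ))} := by
        refine measure_mono fun γ h j hj => ?_
        have := h (5 * j) (by rw [Finset.mem_range] at hj ⊢; omega)
        exact_mod_cast this
    _ = (1 - 1 / 8) ^ (n / 5) := by
        rw [measure_forall_of_pairwiseDisjoint (Finset.range (n / 5))
          (fun j _ k _ hjk => disjoint_segment_of_five_mul i x hjk)
          fun j _ => DependsOn.comp_left (dependsOn_isSeam i _) Not]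
        simp [measure_not (isLocal_isSeam i _), measure_isSeam]

/-- The expected length of the stretches without seams is finite. -/
theorem tsum_measure_seamFree_lt_top (i : Fin d) (x : Site d) :
    ∑' n : ℕ, coinMeasure d {γ | SeamFree i n γ x} < ⊤ := by
  have h78 : (1 - 1 / 8 : ENNReal) = ENNReal.ofReal (7 / 8) := by
    rw [← ENNReal.ofReal_one, ← ENNReal.ofReal_ofNat, ← ENNReal.ofReal_div_of_pos (by norm_num),
      ← ENNReal.ofReal_sub _ (by norm_num)]
    norm_num
  have hreal : Summable fun n : ℕ => (7 / 8 : ℝ) ^ (n / 5) := by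
    refine Summable.of_nonneg_of_le (fun n => by positivity) (fun n => ?_)
      ((summable_geometric_of_lt_one (r := (0.98 : ℝ)) (by norm_num) (by norm_num)).mul_left 2)
    -- Comparison with a geometric series; the factor `2` pays for the remainder lost in `n / 5`.
    have h1 : (7 / 8 : ℝ) ≤ 0.98 ^ 5 := by norm_num
    calc (7 / 8 : ℝ) ^ (n / 5) ≤ (0.98 ^ 5) ^ (n / 5) := pow_le_pow_left₀ (by norm_num) h1 _
      _ = 0.98 ^ (5 * (n / 5)) := by rw [pow_mul]
      _ ≤ 2 * 0.98 ^ n := by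
        conv_rhs => rw [← Nat.div_add_mod n 5, pow_add]
        have h2 : (0.98 : ℝ) ^ 4 ≤ 0.98 ^ (n % 5) :=
          pow_le_pow_of_le_one (by norm_num) (by norm_num) (by omega)
        have h3 : (1 : ℝ) ≤ 2 * 0.98 ^ (n % 5) :=
          le_trans (by norm_num) (mul_le_mul_of_nonneg_left h2 (by norm_num))
        have h4 : (0 : ℝ) < 0.98 ^ (5 * (n / 5)) := by positivity
        nlinarith
  calc ∑' n : ℕ, coinMeasure d {γ | SeamFree i n γ x}
      ≤ ∑' n : ℕ, ENNReal.ofReal ((7 / 8 : ℝ) ^ (n / 5)) := by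
        refine ENNReal.tsum_le_tsum fun n => (measure_seamFree_le i n x).trans_eq ?_
        rw [h78, ENNReal.ofReal_pow (by norm_num)]
    _ = ENNReal.ofReal (∑' n : ℕ, (7 / 8 : ℝ) ^ (n / 5)) :=
        (ENNReal.ofReal_tsum_of_nonneg (fun n => by positivity) hreal).symm
    _ < ⊤ := ENNReal.ofReal_lt_top

/-- The search box with side length `R`. -/
def searchBox (d R : ℕ) : Finset (Site d) := Finset.Icc 0 fun _ => (R : ℤ)

theorem mem_searchBox {R : ℕ} {v : Site d} : v ∈ searchBox d R ↔ ∀ j, 0 ≤ v j ∧ v j ≤ R := by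
  simp [searchBox, Pi.le_def, forall_and]

/-- The box contains `n ^ d` positions, spaced by `5 * m` in direction `i` and by `1` in the others,
whose markers depend on disjoint segments. -/
theorem measure_forall_not_isMarker_le (i : Fin d) {m n R : ℕ} (hm : 1 ≤ m) (hR : 5 * m * n ≤ R) :
    coinMeasure d {γ | ∀ v ∈ searchBox d R, ¬ IsMarker i m γ v} ≤
      (1 - (1 / 8) ^ m) ^ (n ^ d) := by
  classical
  let pt (f : Fin d → Fin n) : Site d := fun j => if j = i then 5 * m * (f j : ℕ) else (f j : ℕ)
  have hpt (f) : pt f ∈ searchBox d R := by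
    refine mem_searchBox.2 fun j => ?_
    have h1 := (f j).2
    have h2 : 5 * m * (f j : ℕ) ≤ 5 * m * n := Nat.mul_le_mul_left _ h1.le
    have h3 : n ≤ 5 * m * n := Nat.le_mul_of_pos_left _ (by omega)
    simp only [pt]
    split_ifs
    · constructor
      · positivity
      · exact_mod_cast h2.trans hR
    · omega
  have hdisj (f g : Fin d → Fin n) (hfg : f ≠ g) :
      Disjoint (segment i (pt f) (-2) (5 * m - 3)) (segment i (pt g) (-2) (5 * m - 3)) := by
    refine disjoint_segment fun s t hs hs' ht ht' heq => hfg (funext fun j => ?_)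
    have hj := congrFun heq j
    by_cases hji : j = i
    · subst hji
      simp only [pt, Pi.add_apply, if_true, Pi.single_eq_same] at hj
      -- The left side is a multiple of `5 * m`, while `|t - s| ≤ 5 * m - 1`.
      have h5 : (5 * m : ℤ) * ((f j : ℕ) - (g j : ℕ) : ℤ) = t - s := by linarith
      have h6 : ((f j : ℕ) - (g j : ℕ) : ℤ) = 0 := by
        by_contra hne
        rcases lt_or_gt_of_ne hne with h | h <;> nlinarith
      exact Fin.ext (by omega)
    · simp only [pt, Pi.add_apply, if_neg hji, Pi.single_eq_of_ne hji, add_zero] at hj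
      exact Fin.ext (by omega)
  calc coinMeasure d {γ | ∀ v ∈ searchBox d R, ¬ IsMarker i m γ v}
      ≤ coinMeasure d {γ | ∀ f ∈ (Finset.univ : Finset (Fin d → Fin n)),
          ¬ IsMarker i m γ (pt f)} := measure_mono fun γ h f _ => h _ (hpt f)
    _ = (1 - (1 / 8) ^ m) ^ (n ^ d) := by
        rw [measure_forall_of_pairwiseDisjoint Finset.univ (fun f _ g _ hfg => hdisj f g hfg)
          fun f _ => DependsOn.comp_left (dependsOn_isMarker i m _) Not]
        simp [measure_not (isLocal_isMarker i m _), measure_isMarker]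

/-! ### Nested partitions

The cells of level `k` are the fibres of `root i k γ`. -/

/-- The radius in which markers of level `k` are searched. -/
def scale (d k : ℕ) : ℕ := 5 * (d * k) * (3 * (d * k) * 8 ^ k)

/-- A fixed choice of an element; `0` for the empty set. -/
def pick (S : Finset (Site d)) : Site d :=
  open Classical in if h : S.Nonempty then h.choose else 0

theorem pick_mem {S : Finset (Site d)} (h : S.Nonempty) : pick S ∈ S := by
  rw [pick, dif_pos h]; exact h.choose_spec

theorem pick_empty : pick (∅ : Finset (Site d)) = 0 := by simp [pick]

open Classical in
/-- The positions, relative to `x`, of the markers of level `k` in the search box at `x`. -/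
def markerOffsets (i : Fin d) (k : ℕ) (γ : Config d) (x : Site d) : Finset (Site d) :=
  (searchBox d (scale d k)).filter fun v => IsMarker i (d * k) γ (x + v)

theorem mem_markerOffsets {i : Fin d} {k : ℕ} {γ : Config d} {x v : Site d} :
    v ∈ markerOffsets i k γ x ↔ v ∈ searchBox d (scale d k) ∧ IsMarker i (d * k) γ (x + v) := by
  simp [markerOffsets]

/-- The root of the cell of level `k` that contains `x`. -/
def root (i : Fin d) : ℕ → Config d → Site d → Site d
  | 0, _, x => x
  | k + 1, γ, x => root i k γ x + pick (markerOffsets i (k + 1) γ (root i k γ x))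

theorem markerOffsets_translate (i : Fin d) (k : ℕ) (γ : Config d) (z x : Site d) :
    markerOffsets i k (translate z γ) (x + z) = markerOffsets i k γ x := by
  ext v
  simp only [mem_markerOffsets, add_right_comm x z, isMarker_translate]

theorem root_translate (i : Fin d) (k : ℕ) (γ : Config d) (z x : Site d) :
    root i k (translate z γ) (x + z) = root i k γ x + z := by
  induction k with
  | zero => rfl
  | succ k ih => simp only [root, ih, markerOffsets_translate, add_right_comm _ z]

/-- The partition sees the coins only through the seams, so flips bounded by seams leave it
unchanged. -/
theorem root_congr {i : Fin d} {γ γ' : Config d} (h : ∀ z, IsSeam i γ z ↔ IsSeam i γ' z) (k : ℕ)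
    (x : Site d) : root i k γ x = root i k γ' x := by
  induction k with
  | zero => rfl
  | succ k ih =>
    have hm (y : Site d) : markerOffsets i (k + 1) γ y = markerOffsets i (k + 1) γ' y := by
      ext v
      simp only [mem_markerOffsets, IsMarker, h]
    simp only [root, ih, hm]

theorem pick_markerOffsets_mem (i : Fin d) (k : ℕ) (γ : Config d) (x : Site d) :
    pick (markerOffsets i k γ x) ∈ searchBox d (scale d k) := by
  rcases (markerOffsets i k γ x).eq_empty_or_nonempty with h | h
  · rw [h, pick_empty, mem_searchBox]; simp
  · exact (mem_markerOffsets.1 (pick_mem h)).1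

/-- The search radii grow geometrically, so the total displacement of a root is at most twice the
last radius. -/
theorem two_mul_scale_le (d k : ℕ) : 2 * scale d k ≤ scale d (k + 1) := by
  unfold scale
  have h1 : d * k ≤ d * (k + 1) := Nat.mul_le_mul_left _ (by omega)
  have h2 : 2 * 8 ^ k ≤ 8 ^ (k + 1) := by rw [pow_succ]; omega
  calc 2 * (5 * (d * k) * (3 * (d * k) * 8 ^ k)) = 5 * (d * k) * (3 * (d * k) * (2 * 8 ^ k)) := by
        ring
    _ ≤ _ := by gcongr

theorem root_sub_mem (i : Fin d) (k : ℕ) (γ : Config d) (x : Site d) :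
    root i k γ x - x ∈ searchBox d (2 * scale d k) := by
  induction k with
  | zero => simp [root, mem_searchBox]
  | succ k ih =>
    have h1 := two_mul_scale_le d k
    have h2 := pick_markerOffsets_mem i (k + 1) γ (root i k γ x)
    rw [mem_searchBox] at ih h2 ⊢
    intro j
    have h3 := ih j
    have h4 := h2 j
    simp only [root, Pi.sub_apply, Pi.add_apply] at h3 ⊢
    push_cast at h3 ⊢
    omega

/-- A root of level `k + 1` is a marker, or there are no markers around it. -/
theorem isMarker_or_of_root_eq {i : Fin d} {k : ℕ} {γ : Config d} {x c : Site d}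
    (h : root i (k + 1) γ x = c) : IsMarker i (d * (k + 1)) γ c ∨
      ∀ v ∈ searchBox d (scale d (k + 1)), ¬ IsMarker i (d * (k + 1)) γ (c + v) := by
  rw [root] at h
  rcases (markerOffsets i (k + 1) γ (root i k γ x)).eq_empty_or_nonempty with he | he
  · rw [he, pick_empty, add_zero] at h
    rw [h] at he
    exact Or.inr fun v hv hm => Finset.notMem_empty v (he ▸ mem_markerOffsets.2 ⟨hv, hm⟩)
  · have := (mem_markerOffsets.1 (pick_mem he)).2
    rw [h] at this
    exact Or.inl this

theorem isLocal_markerOffsets (i : Fin d) (k : ℕ) (x : Site d) :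
    IsLocal fun γ => markerOffsets i k γ x := by
  refine (isLocal_const ()).of_agree (f := fun v γ => IsMarker i (d * k) γ (x + v))
    (fun _ => searchBox d (scale d k)) _ (fun _ => subset_rfl) (fun v _ => isLocal_isMarker i _ _)
    fun γ γ' _ h => Finset.ext fun v => ?_
  rw [mem_markerOffsets, mem_markerOffsets]
  exact and_congr_right fun hv => iff_of_eq (h v hv)

theorem isLocal_root (i : Fin d) (k : ℕ) (x : Site d) : IsLocal fun γ => root i k γ x := by
  classical
  induction k with
  | zero => exact isLocal_const x
  | succ k ih =>
    refine ih.of_agree (f := fun y γ => markerOffsets i (k + 1) γ y) (fun y => {y})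
      ((searchBox d (2 * scale d k)).image fun v => v + x) (fun γ => ?_)
      (fun y _ => isLocal_markerOffsets i _ _) fun γ γ' h1 h2 => ?_
    · rw [Finset.singleton_subset_iff]
      exact Finset.mem_image.2 ⟨_, root_sub_mem i k γ x, sub_add_cancel _ _⟩
    · simp only [Finset.mem_singleton, forall_eq] at h2
      rw [root, h2, h1]; rfl

/-! ### Matching inside the cells -/

/-- Pairs are removed one at a time until one of the two sets is exhausted. -/
theorem exists_pairing {α : Type*} [DecidableEq α] (H : Finset α) :
    ∀ T : Finset α, Disjoint H T → ∃ σ : α → α, (∀ v, σ (σ v) = v) ∧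
      (∀ v, σ v ≠ v → v ∈ H ∧ σ v ∈ T ∨ v ∈ T ∧ σ v ∈ H) ∧
      ((∀ v ∈ H, σ v ≠ v) ∨ ∀ v ∈ T, σ v ≠ v) := by
  induction H using Finset.induction_on with
  | empty => exact fun T _ => ⟨id, by simp⟩
  | insert a H ha ih =>
    intro T hT
    rcases T.eq_empty_or_nonempty with rfl | ⟨b, hb⟩
    · exact ⟨id, by simp⟩
    rw [Finset.disjoint_insert_left] at hT
    have hab : a ≠ b := fun h => hT.1 (h ▸ hb)
    obtain ⟨σ, h1, h2, h3⟩ := ih (T.erase b) (hT.2.mono_right (Finset.erase_subset _ _))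
    have hbH : b ∉ H := fun h => Finset.disjoint_left.1 hT.2 h hb
    have hσa : σ a = a := by
      by_contra h
      rcases h2 a h with h | h
      · exact ha h.1
      · exact hT.1 (Finset.mem_of_mem_erase h.1)
    have hσb : σ b = b := by
      by_contra h
      rcases h2 b h with h | h
      · exact hbH h.1
      · simp at h
    have hinj (v w) (h : σ v = σ w) : v = w := by rw [← h1 v, h, h1]
    have hne (v) (hva : v ≠ a) (hvb : v ≠ b) : σ v ≠ a ∧ σ v ≠ b :=
      ⟨fun h => hva (hinj _ _ (h.trans hσa.symm)), fun h => hvb (hinj _ _ (h.trans hσb.symm))⟩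
    refine ⟨fun v => if v = a then b else if v = b then a else σ v, fun v => ?_, fun v hv => ?_, ?_⟩
    · by_cases hva : v = a
      · simp [hva, hab.symm]
      by_cases hvb : v = b
      · simp [hvb, hab.symm]
      · simp [hva, hvb, hne v hva hvb, h1]
    · by_cases hva : v = a
      · simp [hva, hb]
      by_cases hvb : v = b
      · simp [hvb, hab.symm, hb]
      · simp only [hva, hvb, if_false] at hv ⊢
        rcases h2 v hv with h | h
        · exact Or.inl ⟨by simp [h.1], Finset.mem_of_mem_erase h.2⟩
        · exact Or.inr ⟨Finset.mem_of_mem_erase h.1, by simp [h.2]⟩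
    · refine h3.imp (fun h v hv => ?_) fun h v hv => ?_
      · by_cases hva : v = a
        · simp [hva, hab.symm]
        by_cases hvb : v = b
        · simp [hvb, hab, hab.symm]
        · simp only [hva, hvb, if_false]
          exact h v (by simpa [hva] using hv)
      · by_cases hva : v = a
        · simp [hva, hab.symm]
        by_cases hvb : v = b
        · simp [hvb, hab, hab.symm]
        · simp only [hva, hvb, if_false]
          exact h v (by simp [hvb, hv])

/-- A fixed choice of a maximal pairing of elements of `H` with elements of `T`, as an involution
that fixes the other elements. -/
def pairing (H T : Finset (Site d)) : Site d → Site d :=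
  if h : Disjoint H T then (exists_pairing H T h).choose else id

/-- Sites of the cell with root `c`, given relative to `c`, that are fixed by `M` and have
coin `b`. -/
def freeOffsets (i : Fin d) (k : ℕ) (γ : Config d) (M : Site d → Site d) (c : Site d) (b : Bool) :
    Finset (Site d) :=
  (searchBox d (2 * scale d k)).filter fun v =>
    root i k γ (c - v) = c ∧ M (c - v) = c - v ∧ γ (c - v) = b

/-- The matching after level `k`, as an involution that fixes the unmatched sites. -/
def matching (i : Fin d) : ℕ → Config d → Site d → Site d
  | 0, _, x => x
  | k + 1, γ, x =>
    if matching i k γ x ≠ x then matching i k γ x else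
      root i (k + 1) γ x - pairing
        (freeOffsets i (k + 1) γ (matching i k γ) (root i (k + 1) γ x) true)
        (freeOffsets i (k + 1) γ (matching i k γ) (root i (k + 1) γ x) false)
        (root i (k + 1) γ x - x)

theorem matching_succ_of_ne {i : Fin d} {k : ℕ} {γ : Config d} {x : Site d}
    (h : matching i k γ x ≠ x) : matching i (k + 1) γ x = matching i k γ x := by
  rw [matching, if_pos h]

theorem matching_translate (i : Fin d) (k : ℕ) (γ : Config d) (z x : Site d) :
    matching i k (translate z γ) (x + z) = matching i k γ x + z := by
  induction k generalizing x with
  | zero => rfl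
  | succ k ih =>
    have hfree (c : Site d) (b : Bool) :
        freeOffsets i (k + 1) (translate z γ) (matching i k (translate z γ)) (c + z) b =
          freeOffsets i (k + 1) γ (matching i k γ) c b := by
      refine Finset.filter_congr fun v _ => ?_
      rw [show c + z - v = c - v + z by abel, root_translate, ih]
      simp [translate]
    simp only [matching, root_translate, ih, hfree, ne_eq, add_left_inj, add_sub_add_right_eq_sub]
    split_ifs
    · abel
    · rfl

theorem isLocal_matching (i : Fin d) (k : ℕ) (x : Site d) : IsLocal fun γ => matching i k γ x := by
  classical
  induction k generalizing x with
  | zero => exact isLocal_const x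
  | succ k ih =>
    refine ((isLocal_root i (k + 1) x).comp₂ (ih x) Prod.mk).of_agree
      (f := fun y γ => (root i (k + 1) γ y, matching i k γ y, γ y))
      (fun c => (searchBox d (2 * scale d (k + 1))).image fun v => c.1 - v)
      (((searchBox d (2 * scale d (k + 1))) ×ˢ (searchBox d (2 * scale d (k + 1)))).image
        fun p => p.1 + x - p.2) (fun γ => ?_)
      (fun y _ => (isLocal_root i (k + 1) y).comp₂ ((ih y).comp₂ (isLocal_eval y) Prod.mk) Prod.mk)
      fun γ γ' h1 h2 => ?_
    · refine Finset.image_subset_iff.2 fun v hv => Finset.mem_image.2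
        ⟨(root i (k + 1) γ x - x, v), Finset.mem_product.2 ⟨root_sub_mem i (k + 1) γ x, hv⟩, ?_⟩
      simp
    · simp only [Prod.mk.injEq, Finset.forall_mem_image] at h1 h2
      have hfree (b : Bool) :
          freeOffsets i (k + 1) γ (matching i k γ) (root i (k + 1) γ x) b =
            freeOffsets i (k + 1) γ' (matching i k γ') (root i (k + 1) γ x) b :=
        Finset.filter_congr fun v hv => by rw [(h2 hv).1, (h2 hv).2.1, (h2 hv).2.2]
      rw [h1.1] at hfree
      simp only [matching, hfree, h1.1, h1.2]

/-- `M` is an involution that matches heads to tails inside the fibres of `ρ`, such that the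
unmatched sites in each fibre are all heads or all tails. -/
structure IsMaximalMatching (γ : Config d) (ρ M : Site d → Site d) : Prop where
  involutive : ∀ x, M (M x) = x
  coin_ne : ∀ x, M x ≠ x → γ (M x) ≠ γ x
  root_eq : ∀ x, ρ (M x) = ρ x
  coin_eq : ∀ x y, ρ x = ρ y → M x = x → M y = y → γ x = γ y

/-- The next root is a function of the previous one, so cells are nested and earlier pairs stay
inside a cell. The new level only pairs the remaining sites of each cell, and maximality leaves a
single kind of coin. -/
theorem isMaximalMatching_matching (i : Fin d) (k : ℕ) (γ : Config d) :
    IsMaximalMatching γ (root i k γ) (matching i k γ) := by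
  induction k with
  | zero =>
    exact ⟨fun _ => rfl, fun _ h => (h rfl).elim, fun _ => rfl, fun x y h _ _ => congrArg γ h⟩
  | succ k ih =>
    have hmem (x : Site d) (h : matching i k γ x = x) : root i (k + 1) γ x - x ∈
        freeOffsets i (k + 1) γ (matching i k γ) (root i (k + 1) γ x) (γ x) :=
      Finset.mem_filter.2 ⟨root_sub_mem i (k + 1) γ x, by simp [h]⟩
    have hdisj (c : Site d) : Disjoint (freeOffsets i (k + 1) γ (matching i k γ) c true)
        (freeOffsets i (k + 1) γ (matching i k γ) c false) := by
      rw [Finset.disjoint_left]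
      intro v hv hv'
      have h1 := (Finset.mem_filter.1 hv).2.2.2
      rw [(Finset.mem_filter.1 hv').2.2.2] at h1
      exact Bool.noConfusion h1
    have hroot (x : Site d) : root i (k + 1) γ (matching i k γ x) = root i (k + 1) γ x := by
      rw [root, root, ih.root_eq]
    have hcell (x : Site d) (hx : matching i k γ x = x) (hx' : matching i (k + 1) γ x ≠ x) :
        matching i k γ (matching i (k + 1) γ x) = matching i (k + 1) γ x ∧
        root i (k + 1) γ (matching i (k + 1) γ x) = root i (k + 1) γ x ∧
        γ (matching i (k + 1) γ x) ≠ γ x ∧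
        matching i (k + 1) γ (matching i (k + 1) γ x) = x := by
      obtain ⟨h1, h2, -⟩ := (exists_pairing _ _ (hdisj (root i (k + 1) γ x))).choose_spec
      have hy : matching i (k + 1) γ x = root i (k + 1) γ x - pairing
        (freeOffsets i (k + 1) γ (matching i k γ) (root i (k + 1) γ x) true)
        (freeOffsets i (k + 1) γ (matching i k γ) (root i (k + 1) γ x) false)
        (root i (k + 1) γ x - x) := by rw [matching, if_neg (not_not.2 hx)]
      rw [pairing, dif_pos (hdisj _)] at hy
      set σ := (exists_pairing _ _ (hdisj (root i (k + 1) γ x))).choose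
      set c := root i (k + 1) γ x
      have hσ : σ (c - x) ≠ c - x := fun h => hx' (by rw [hy, h]; abel)
      have key : matching i k γ (matching i (k + 1) γ x) = matching i (k + 1) γ x ∧
          root i (k + 1) γ (matching i (k + 1) γ x) = c ∧ γ (matching i (k + 1) γ x) ≠ γ x := by
        rw [hy]
        rcases h2 _ hσ with ⟨ha, hb⟩ | ⟨ha, hb⟩ <;>
        · have ha' := (Finset.mem_filter.1 ha).2.2.2
          have hb' := (Finset.mem_filter.1 hb).2
          rw [sub_sub_cancel] at ha'
          exact ⟨hb'.2.1, hb'.1, by rw [ha', hb'.2.2]; decide⟩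
      refine ⟨key.1, key.2.1, key.2.2, ?_⟩
      rw [matching, if_neg (not_not.2 key.1), key.2.1, pairing, dif_pos (hdisj _)]
      change c - σ (c - matching i (k + 1) γ x) = x
      rw [hy, sub_sub_cancel, h1, sub_sub_cancel]
    refine ⟨fun x => ?_, fun x hx' => ?_, fun x => ?_, fun x y hxy hx' hy' => ?_⟩
    · by_cases hx : matching i k γ x = x
      · by_cases hx' : matching i (k + 1) γ x = x
        · rw [hx', hx']
        · exact (hcell x hx hx').2.2.2
      · rw [matching_succ_of_ne hx, matching_succ_of_ne (by rw [ih.involutive]; exact Ne.symm hx),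
          ih.involutive]
    · by_cases hx : matching i k γ x = x
      · exact (hcell x hx hx').2.2.1
      · rw [matching_succ_of_ne hx]; exact ih.coin_ne x hx
    · by_cases hx : matching i k γ x = x
      · by_cases hx' : matching i (k + 1) γ x = x
        · rw [hx']
        · exact (hcell x hx hx').2.1
      · rw [matching_succ_of_ne hx, hroot]
    · have hk (x : Site d) (hx' : matching i (k + 1) γ x = x) : matching i k γ x = x := by
        by_contra h
        exact h ((matching_succ_of_ne h).symm.trans hx')
      have hx := hk x hx'
      have hy := hk y hy'
      have hmx := hmem x hx
      have hmy := hmem y hy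
      rw [matching, if_neg (not_not.2 hx), pairing, dif_pos (hdisj _), sub_eq_iff_eq_add',
        ← sub_eq_iff_eq_add] at hx'
      rw [matching, if_neg (not_not.2 hy), pairing, dif_pos (hdisj _), ← hxy, sub_eq_iff_eq_add',
        ← sub_eq_iff_eq_add] at hy'
      rw [← hxy] at hmy
      obtain ⟨-, -, h3⟩ := (exists_pairing _ _ (hdisj (root i (k + 1) γ x))).choose_spec
      by_contra hne
      rcases h3 with h3 | h3
      · cases hgx : γ x <;> cases hgy : γ y <;> rw [hgx] at hmx <;> rw [hgy] at hmy
        · exact hne (hgx.trans hgy.symm)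
        · exact h3 _ hmy hy'.symm
        · exact h3 _ hmx hx'.symm
        · exact hne (hgx.trans hgy.symm)
      · cases hgx : γ x <;> cases hgy : γ y <;> rw [hgx] at hmx <;> rw [hgy] at hmy
        · exact hne (hgx.trans hgy.symm)
        · exact h3 _ hmx hx'.symm
        · exact h3 _ hmy hy'.symm
        · exact hne (hgx.trans hgy.symm)

/-! ### The number of unmatched sites in a cell -/

/-- The sign of a coin. -/
def sign (b : Bool) : ℝ := if b then 1 else -1

theorem sign_not (b : Bool) : sign (!b) = -sign b := by cases b <;> simp [sign]

theorem sign_eq_neg {a b : Bool} (h : a ≠ b) : sign a = -sign b := by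
  cases a <;> cases b <;> simp_all [sign]

theorem abs_sign (b : Bool) : |sign b| = 1 := by cases b <;> simp [sign]

/-- The indicator of a proposition. -/
def ind (p : Prop) : ℝ := open Classical in if p then 1 else 0

theorem ind_of_true {p : Prop} (h : p) : ind p = 1 := if_pos h

theorem ind_of_false {p : Prop} (h : ¬ p) : ind p = 0 := if_neg h

theorem ind_nonneg (p : Prop) : 0 ≤ ind p := by unfold ind; split_ifs <;> simp

theorem ind_le_one (p : Prop) : ind p ≤ 1 := by unfold ind; split_ifs <;> simp

theorem ind_and (p q : Prop) : ind (p ∧ q) = ind p * ind q := by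
  by_cases hp : p <;> by_cases hq : q <;> simp [ind, hp, hq]

theorem IsLocal.integrable {f : Config d → ℝ} (hf : IsLocal f) :
    Integrable f (coinMeasure d) := by
  have hm : Measurable f := hf.measurable
  obtain ⟨S, hS⟩ := hf
  obtain ⟨g, hg⟩ := exists_eq_comp_restrict hS
  obtain ⟨C, hC⟩ := (Set.finite_range fun η => ‖g η‖).bddAbove
  exact Integrable.of_bound hm.aestronglyMeasurable C
    (Filter.Eventually.of_forall fun γ => hg γ ▸ hC ⟨_, rfl⟩)

theorem integral_ind {p : Config d → Prop} (hp : IsLocal p) :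
    ∫ γ, ind (p γ) ∂(coinMeasure d) = (coinMeasure d).real {γ | p γ} := by
  rw [← integral_indicator_one hp.measurableSet]
  refine integral_congr_ae (Filter.Eventually.of_forall fun γ => ?_)
  by_cases h : p γ <;> simp [ind, h, Set.indicator]

theorem neg_mem_searchBox {i : Fin d} {k : ℕ} {γ : Config d} {x : Site d}
    (h : root i k γ x = 0) : -x ∈ searchBox d (2 * scale d k) := by
  have := root_sub_mem i k γ x
  rwa [h, zero_sub] at this

/-- The excess of heads over tails in the cell of level `k` with root `0`. -/
def excess (i : Fin d) (k : ℕ) (γ : Config d) : ℝ :=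
  ∑ v ∈ searchBox d (2 * scale d k), sign (γ (-v)) * ind (root i k γ (-v) = 0)

/-- Matched pairs lie in one cell and cancel in the excess, whereas all unmatched sites of a cell
carry the same sign. -/
theorem sum_free_eq_abs_excess (i : Fin d) (k : ℕ) (γ : Config d) :
    ∑ v ∈ searchBox d (2 * scale d k), ind (matching i k γ (-v) = -v ∧ root i k γ (-v) = 0) =
      |excess i k γ| := by
  have hM := isMaximalMatching_matching i k γ
  set B := searchBox d (2 * scale d k)
  have hsplit : excess i k γ = ∑ v ∈ B,
      sign (γ (-v)) * ind (matching i k γ (-v) = -v ∧ root i k γ (-v) = 0) := by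
    rw [← sub_eq_zero, excess, ← Finset.sum_sub_distrib]
    rw [← Finset.sum_filter_ne_zero]
    have hiff (v : Site d) : sign (γ (-v)) * ind (root i k γ (-v) = 0) -
        sign (γ (-v)) * ind (matching i k γ (-v) = -v ∧ root i k γ (-v) = 0) =
        if matching i k γ (-v) ≠ -v ∧ root i k γ (-v) = 0 then sign (γ (-v)) else 0 := by
      by_cases h1 : matching i k γ (-v) = -v <;> by_cases h2 : root i k γ (-v) = 0 <;>
        simp [ind, h1, h2]
    simp only [hiff]
    have hne (v) (hv : v ∈ B.filter fun v => (if matching i k γ (-v) ≠ -v ∧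
        root i k γ (-v) = 0 then sign (γ (-v)) else 0) ≠ 0) :
        matching i k γ (-v) ≠ -v ∧ root i k γ (-v) = 0 := by
      by_contra h
      exact (Finset.mem_filter.1 hv).2 (if_neg h)
    refine Finset.sum_involution (fun v _ => -matching i k γ (-v)) (fun v hv => ?_)
      (fun v hv _ h => ?_) (fun v hv => ?_) (fun v hv => ?_)
    · have h := hne v hv
      rw [if_pos h, neg_neg, hM.involutive, hM.root_eq, if_pos ⟨Ne.symm h.1, h.2⟩,
        sign_eq_neg (hM.coin_ne _ h.1), add_neg_cancel]
    · exact (hne v hv).1 (neg_eq_iff_eq_neg.1 h)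
    · have h := hne v hv
      have hr : root i k γ (matching i k γ (-v)) = 0 := by rw [hM.root_eq, h.2]
      refine Finset.mem_filter.2 ⟨neg_mem_searchBox hr, ?_⟩
      rw [neg_neg, hM.involutive, if_pos ⟨Ne.symm h.1, hr⟩]
      intro h0
      simpa [h0] using abs_sign (γ (matching i k γ (-v)))
    · simp only [neg_neg, hM.involutive]
  rw [hsplit]
  by_cases hex : ∃ w ∈ B, matching i k γ (-w) = -w ∧ root i k γ (-w) = 0
  · obtain ⟨w, -, hw⟩ := hex
    have (v : Site d) : sign (γ (-v)) * ind (matching i k γ (-v) = -v ∧ root i k γ (-v) = 0) =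
        sign (γ (-w)) * ind (matching i k γ (-v) = -v ∧ root i k γ (-v) = 0) := by
      by_cases hv : matching i k γ (-v) = -v ∧ root i k γ (-v) = 0
      · rw [hM.coin_eq (-v) (-w) (hv.2.trans hw.2.symm) hv.1 hw.1]
      · rw [ind_of_false hv, mul_zero, mul_zero]
    rw [Finset.sum_congr rfl fun v _ => this v, ← Finset.mul_sum, abs_mul, abs_sign, one_mul,
      abs_of_nonneg (Finset.sum_nonneg fun v _ => ind_nonneg _)]
  · push Not at hex
    have (v) (hv : v ∈ B) : ind (matching i k γ (-v) = -v ∧ root i k γ (-v) = 0) = 0 :=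
      ind_of_false fun h => hex v hv h.1 h.2
    rw [Finset.sum_eq_zero this, Finset.sum_eq_zero fun v hv => by rw [this v hv, mul_zero],
      abs_zero]

/-- Mass transport from the origin to the root of its cell. -/
theorem sum_measure_root (i : Fin d) (k : ℕ) {P : Config d → Site d → Prop}
    (hP : ∀ x, IsLocal fun γ => P γ x)
    (hPt : ∀ γ z x, P (translate z γ) (x + z) ↔ P γ x) :
    ∑ v ∈ searchBox d (2 * scale d k),
      (coinMeasure d).real {γ | P γ (-v) ∧ root i k γ (-v) = 0} =
      (coinMeasure d).real {γ | P γ 0} := by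
  have hr (v c : Site d) : IsLocal fun γ => root i k γ v = c :=
    (isLocal_root i k v).comp_left (· = c)
  have hloc (v c : Site d) : IsLocal fun γ => P γ v ∧ root i k γ v = c := (hP v).comp₂ (hr v c) And
  -- Translation by `v` moves the site `-v` to the origin and its root from the origin to `v`;
  -- summing over `v` then exhausts the possible roots of the origin.
  have h1 (v : Site d) : (coinMeasure d).real {γ | P γ (-v) ∧ root i k γ (-v) = 0} =
      (coinMeasure d).real {γ | P γ 0 ∧ root i k γ 0 = v} := by
    refine congrArg ENNReal.toReal (measure_translate (-v) (hloc (-v) 0).measurableSet fun γ => ?_)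
    have h1 := hPt γ (-v) 0
    have h2 := root_translate i k γ (-v) 0
    rw [zero_add] at h1 h2
    rw [h1, h2, add_neg_eq_zero]
  simp only [h1]
  simp only [← integral_ind (hloc 0 _), ← integral_ind (hP 0)]
  rw [← integral_finsetSum _ fun v _ => ((hloc 0 v).comp_left ind).integrable]
  congr 1
  funext γ
  rw [Finset.sum_eq_single (root i k γ 0)]
  · simp only [and_true]
  · intro v _ hv
    exact ind_of_false fun h => hv h.2.symm
  · intro h
    have := root_sub_mem i k γ 0
    rw [sub_zero] at this
    exact (h this).elim

theorem isLocal_matching_eq (i : Fin d) (k : ℕ) (x y : Site d) :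
    IsLocal fun γ => matching i k γ x = y :=
  (isLocal_matching i k x).comp_left (· = y)

theorem isLocal_root_eq (i : Fin d) (k : ℕ) (x y : Site d) : IsLocal fun γ => root i k γ x = y :=
  (isLocal_root i k x).comp_left (· = y)

theorem IsLocal.sum {ι : Type*} (s : Finset ι) {f : ι → Config d → ℝ}
    (hf : ∀ v ∈ s, IsLocal (f v)) : IsLocal fun γ => ∑ v ∈ s, f v γ :=
  (isLocal_const ()).of_agree (fun _ => s) s (fun _ => subset_rfl) hf
    fun _ _ _ h => Finset.sum_congr rfl h

theorem isLocal_excess (i : Fin d) (k : ℕ) : IsLocal fun γ => excess i k γ :=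
  .sum _ fun v _ => ((isLocal_eval (-v)).comp_left sign).comp₂
    ((isLocal_root_eq i k (-v) 0).comp_left ind) (· * ·)

/-- Every unmatched site sends unit mass to its root, where the mass received is the absolute
excess. -/
theorem measure_free_eq (i : Fin d) (k : ℕ) :
    (coinMeasure d).real {γ | matching i k γ 0 = 0} =
      ∫ γ, |excess i k γ| ∂(coinMeasure d) := by
  have hloc (v : Site d) : IsLocal fun γ => matching i k γ (-v) = -v ∧ root i k γ (-v) = 0 :=
    (isLocal_matching_eq i k _ _).comp₂ (isLocal_root_eq i k _ _) And
  rw [← sum_measure_root i k (P := fun γ x => matching i k γ x = x)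
    (fun x => isLocal_matching_eq i k x x)
    fun γ z x => by rw [matching_translate, add_left_inj]]
  simp only [← sum_free_eq_abs_excess, ← integral_ind (hloc _)]
  rw [integral_finsetSum _ fun v _ => ((hloc v).comp_left ind).integrable]

/-! ### The second moment of the excess -/

theorem integral_comp_flip (A : Set (Site d)) {f : Config d → ℝ} (hf : IsLocal f) :
    ∫ γ, f (flip A γ) ∂(coinMeasure d) = ∫ γ, f γ ∂(coinMeasure d) := by
  have h := measurePreserving_flip (d := d) A
  conv_rhs => rw [← h.map_eq]
  exact (integral_map h.measurable.aemeasurable hf.measurable.aestronglyMeasurable).symm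

/-- The contribution of the sites `x`, `y` to the square of the excess. -/
def pairTerm (i : Fin d) (k : ℕ) (x y : Site d) (γ : Config d) : ℝ :=
  sign (γ x) * ind (root i k γ x = 0) * (sign (γ y) * ind (root i k γ y = 0))

theorem isLocal_pairTerm (i : Fin d) (k : ℕ) (x y : Site d) : IsLocal (pairTerm i k x y) :=
  (((isLocal_eval x).comp_left sign).comp₂ ((isLocal_root_eq i k x 0).comp_left ind) (· * ·)).comp₂
    (((isLocal_eval y).comp_left sign).comp₂ ((isLocal_root_eq i k y 0).comp_left ind) (· * ·))
    (· * ·)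

theorem pairTerm_comm (i : Fin d) (k : ℕ) (x y : Site d) :
    pairTerm i k x y = pairTerm i k y x :=
  funext fun _ => mul_comm _ _

theorem abs_pairTerm_le (i : Fin d) (k : ℕ) (x y : Site d) (γ : Config d) :
    |pairTerm i k x y γ| ≤ ind (root i k γ x = 0) := by
  rw [pairTerm, abs_mul, abs_mul, abs_mul, abs_sign, abs_sign, one_mul, one_mul,
    abs_of_nonneg (ind_nonneg _), abs_of_nonneg (ind_nonneg _)]
  exact mul_le_of_le_one_right (ind_nonneg _) (ind_le_one _)

/-- Pairs of sites that are separated by a set with boundary in the seams do not contribute. -/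
theorem integral_pairTerm_of_separated {i : Fin d} (k : ℕ) {x y : Site d} {E : Config d → Prop}
    (hE : IsLocal E) {A : Set (Site d)} (hx : x ∈ A) (hy : y ∉ A)
    (hcongr : ∀ γ γ', (∀ z, IsSeam i γ z ↔ IsSeam i γ' z) → (E γ → E γ'))
    (hA : ∀ γ, E γ → ∀ w, (w ∈ A ↔ w + Pi.single i 1 ∈ A) ∨ IsSeam i γ w) :
    ∫ γ, pairTerm i k x y γ * ind (E γ) ∂(coinMeasure d) = 0 := by
  have h1 := integral_comp_flip A ((isLocal_pairTerm i k x y).comp₂ (hE.comp_left ind) (· * ·))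
  -- On `E` the flip preserves seams, hence roots and `E` itself, and reverses the sign at `x` but
  -- not at `y`.
  have h2 (γ : Config d) : pairTerm i k x y (flip A γ) * ind (E (flip A γ)) =
      -(pairTerm i k x y γ * ind (E γ)) := by
    by_cases h : E γ
    · have hs := fun z => isSeam_flip (hA γ h) z
      have h' : E (flip A γ) := hcongr γ _ (fun z => (hs z).symm) h
      simp only [pairTerm, root_congr hs, flip_of_mem hx, flip_of_notMem hy, sign_not,
        ind_of_true h, ind_of_true h']
      ring
    · have h' : ¬ E (flip A γ) := fun h' => h <| by
        have := hcongr (flip A γ) _ (fun z => (isSeam_flip (hA _ h') z).symm) h'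
        rwa [flip_flip] at this
      rw [ind_of_false h, ind_of_false h']
      ring
  simp only [h2, integral_neg] at h1
  linarith

/-- The line in direction `i` through `x`, up to coordinate `t`. -/
def ray (i : Fin d) (x : Site d) (t : ℤ) : Set (Site d) := {w | ∃ u ≤ t, w = x + Pi.single i u}

theorem mem_ray_iff (i : Fin d) (x : Site d) (t : ℤ) (w : Site d) :
    (w ∈ ray i x t ↔ w + Pi.single i 1 ∈ ray i x t) ∨ w = x + Pi.single i t := by
  by_cases h : w = x + Pi.single i t
  · exact Or.inr h
  · refine Or.inl ⟨?_, ?_⟩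
    · rintro ⟨u, hu, rfl⟩
      refine ⟨u + 1, ?_, add_single_add_single _ _ _ _⟩
      rw [add_single_inj] at h
      omega
    · rintro ⟨u, hu, hw⟩
      refine ⟨u - 1, by omega, ?_⟩
      rw [eq_sub_of_add_eq hw, add_sub_assoc, ← Pi.single_sub]

/-- The whole line through `x` in direction `i` can be flipped: it has no boundary in that
direction. -/
theorem integral_pairTerm_of_ne {i : Fin d} (k : ℕ) {x y : Site d}
    (h : ∀ t : ℤ, y ≠ x + Pi.single i t) :
    ∫ γ, pairTerm i k x y γ ∂(coinMeasure d) = 0 := by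
  have := integral_pairTerm_of_separated (i := i) k (x := x) (y := y) (E := fun _ => True)
    (isLocal_const _) (A := {w | ∃ u : ℤ, w = x + Pi.single i u}) ⟨0, by simp⟩
    (fun ⟨u, hu⟩ => h u hu) (fun _ _ _ _ => trivial) fun γ _ w => Or.inl ⟨?_, ?_⟩
  · simpa [ind_of_true] using this
  · rintro ⟨u, rfl⟩
    exact ⟨u + 1, add_single_add_single _ _ _ _⟩
  · rintro ⟨u, hw⟩
    exact ⟨u - 1, by rw [eq_sub_of_add_eq hw, add_sub_assoc, ← Pi.single_sub]⟩

theorem seamFree_succ (i : Fin d) (n : ℕ) (γ : Config d) (x : Site d) :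
    SeamFree i (n + 1) γ x ↔ SeamFree i n γ x ∧ ¬ IsSeam i γ (x + Pi.single i (n : ℤ)) := by
  simp only [SeamFree, Finset.range_add_one, Finset.forall_mem_insert]
  exact and_comm

/-- On the event that the first seam after `x` is at offset `m < n`, flipping the ray that ends
there separates the two sites, so this event contributes zero and can be removed. -/
theorem integral_pairTerm_seamFree (i : Fin d) (k : ℕ) (x : Site d) (n m : ℕ) (hmn : m ≤ n) :
    ∫ γ, pairTerm i k x (x + Pi.single i (n : ℤ)) γ * ind (SeamFree i m γ x) ∂(coinMeasure d) =
      ∫ γ, pairTerm i k x (x + Pi.single i (n : ℤ)) γ ∂(coinMeasure d) := by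
  induction m with
  | zero => simp [SeamFree, ind_of_true]
  | succ m ih =>
    rw [← ih (by omega)]
    have hloc : IsLocal fun γ => SeamFree i m γ x ∧ IsSeam i γ (x + Pi.single i (m : ℤ)) :=
      (isLocal_seamFree i m x).comp₂ (isLocal_isSeam i _) And
    have h0 := integral_pairTerm_of_separated (i := i) k (x := x)
      (y := x + Pi.single i (n : ℤ)) hloc (A := ray i x m) ⟨0, by simp, by simp⟩
      (fun ⟨u, hu, h⟩ => by rw [add_single_inj] at h; omega)
      (fun γ γ' h hE => ⟨fun t ht => (h _).not.1 (hE.1 t ht), (h _).1 hE.2⟩)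
      (fun γ hE w => (mem_ray_iff i x m w).imp_right fun h => by rw [h]; exact hE.2)
    rw [← add_zero (∫ γ, _ ∂_), ← h0, ← integral_add]
    · refine integral_congr_ae (Filter.Eventually.of_forall fun γ => ?_)
      simp only [seamFree_succ]
      by_cases h1 : SeamFree i m γ x <;> by_cases h2 : IsSeam i γ (x + Pi.single i (m : ℤ)) <;>
        simp [ind, h1, h2]
    · exact ((isLocal_pairTerm i k _ _).comp₂
        ((isLocal_seamFree i (m + 1) x).comp_left ind) (· * ·)).integrable
    · exact ((isLocal_pairTerm i k _ _).comp₂ (hloc.comp_left ind) (· * ·)).integrable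

theorem abs_integral_pairTerm_le (i : Fin d) (k : ℕ) (x : Site d) (n : ℕ) :
    |∫ γ, pairTerm i k x (x + Pi.single i (n : ℤ)) γ ∂(coinMeasure d)| ≤
      (coinMeasure d).real {γ | SeamFree i n γ x ∧ root i k γ x = 0} := by
  have hloc : IsLocal fun γ => SeamFree i n γ x ∧ root i k γ x = 0 :=
    (isLocal_seamFree i n x).comp₂ (isLocal_root_eq i k x 0) And
  rw [← integral_pairTerm_seamFree i k x n n le_rfl, ← integral_ind hloc]
  refine (abs_integral_le_integral_abs).trans (integral_mono ?_ ?_ fun γ => ?_)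
  · exact (((isLocal_pairTerm i k _ _).comp₂
      ((isLocal_seamFree i n x).comp_left ind) (· * ·)).comp_left abs).integrable
  · exact (hloc.comp_left ind).integrable
  · simp only [abs_mul, ind_and, abs_of_nonneg (ind_nonneg (SeamFree i n γ x))]
    rw [mul_comm]
    exact mul_le_mul_of_nonneg_left (abs_pairTerm_le _ _ _ _ _) (ind_nonneg _)

/-- The expected number of sites that follow `0` without a seam in between. -/
def meanRun (i : Fin d) : ℝ := ∑' n : ℕ, (coinMeasure d).real {γ | SeamFree i n γ 0}

theorem sum_measure_seamFree_le (i : Fin d) (N : ℕ) :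
    ∑ n ∈ Finset.range N, (coinMeasure d).real {γ | SeamFree i n γ 0} ≤ meanRun i :=
  (ENNReal.summable_toReal (tsum_measure_seamFree_lt_top i 0).ne).sum_le_tsum _
    fun _ _ => measureReal_nonneg

/-- The probability that the cell with root `0` contains `-v` and that there is no seam in the run
of length `n` from there. -/
def runProb (i : Fin d) (k : ℕ) (v : Site d) (n : ℕ) : ℝ :=
  (coinMeasure d).real {γ | SeamFree i n γ (-v) ∧ root i k γ (-v) = 0}

/-- `runProb` if `w` is `n` steps away from `v`. -/
def stepProb (i : Fin d) (k : ℕ) (v w : Site d) (n : ℕ) : ℝ :=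
  if w = v - Pi.single i (n : ℤ) then runProb i k v n else 0

theorem runProb_nonneg (i : Fin d) (k : ℕ) (v : Site d) (n : ℕ) : 0 ≤ runProb i k v n :=
  measureReal_nonneg

theorem stepProb_nonneg (i : Fin d) (k : ℕ) (v w : Site d) (n : ℕ) : 0 ≤ stepProb i k v w n := by
  unfold stepProb
  split_ifs
  · exact runProb_nonneg i k v n
  · exact le_rfl

theorem integral_pairTerm_le_stepProb (i : Fin d) (k : ℕ) {v w : Site d} {n : ℕ}
    (h : -w = -v + Pi.single i (n : ℤ)) :
    ∫ γ, pairTerm i k (-v) (-w) γ ∂(coinMeasure d) ≤ stepProb i k v w n := by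
  have hwv : w = v - Pi.single i (n : ℤ) := by rw [← neg_neg w, h]; abel
  rw [stepProb, if_pos hwv, h]
  exact (le_abs_self _).trans (abs_integral_pairTerm_le i k (-v) n)

theorem integral_pairTerm_le (i : Fin d) {k N : ℕ} (hN : 2 * scale d k < N) {v w : Site d}
    (hv : v ∈ searchBox d (2 * scale d k)) (hw : w ∈ searchBox d (2 * scale d k)) :
    ∫ γ, pairTerm i k (-v) (-w) γ ∂(coinMeasure d) ≤
      ∑ n ∈ Finset.range N, (stepProb i k v w n + stepProb i k w v n) := by
  have hnn (n : ℕ) : 0 ≤ stepProb i k v w n + stepProb i k w v n :=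
    add_nonneg (stepProb_nonneg _ _ _ _ _) (stepProb_nonneg _ _ _ _ _)
  by_cases h : ∃ t : ℤ, -w = -v + Pi.single i t
  · obtain ⟨t, ht⟩ := h
    have hti : -w i = -v i + t := by simpa using congrFun ht i
    have hvi := mem_searchBox.1 hv i
    have hwi := mem_searchBox.1 hw i
    have hn : t.natAbs ∈ Finset.range N := by
      rw [Finset.mem_range]; omega
    refine le_trans ?_ (Finset.single_le_sum (fun n _ => hnn n) hn)
    rcases le_total 0 t with h0 | h0
    · have := integral_pairTerm_le_stepProb i k (v := v) (w := w) (n := t.natAbs)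
        (by rw [ht, Int.natAbs_of_nonneg h0])
      linarith [stepProb_nonneg i k w v t.natAbs]
    · have := integral_pairTerm_le_stepProb i k (v := w) (w := v) (n := t.natAbs)
        (by rw [ht, Int.ofNat_natAbs_of_nonpos h0, Pi.single_neg]; abel)
      rw [pairTerm_comm]
      linarith [stepProb_nonneg i k v w t.natAbs]
  · push Not at h
    rw [integral_pairTerm_of_ne k h]
    exact Finset.sum_nonneg fun n _ => hnn n

/-- Each `v` and `n` allow at most one `w`; mass transport moves the start of the run to the origin,
and the level disappears from the bound. -/
theorem sum_stepProb_le (i : Fin d) (k N : ℕ) :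
    ∑ v ∈ searchBox d (2 * scale d k), ∑ w ∈ searchBox d (2 * scale d k), ∑ n ∈ Finset.range N,
      stepProb i k v w n ≤ meanRun i := by
  calc _ ≤ ∑ v ∈ searchBox d (2 * scale d k), ∑ n ∈ Finset.range N, runProb i k v n := by
        refine Finset.sum_le_sum fun v _ => ?_
        rw [Finset.sum_comm]
        refine Finset.sum_le_sum fun n _ => ?_
        unfold stepProb
        rw [Finset.sum_ite_eq']
        split_ifs
        · exact le_rfl
        · exact runProb_nonneg i k v n
    _ = ∑ n ∈ Finset.range N, (coinMeasure d).real {γ | SeamFree i n γ 0} := by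
        rw [Finset.sum_comm]
        exact Finset.sum_congr rfl fun n _ => sum_measure_root i k
          (P := fun γ x => SeamFree i n γ x) (fun x => isLocal_seamFree i n x)
          fun γ z x => seamFree_translate i n γ z x
    _ ≤ meanRun i := sum_measure_seamFree_le i N

theorem integral_excess_sq_eq (i : Fin d) (k : ℕ) :
    ∫ γ, excess i k γ ^ 2 ∂(coinMeasure d) = ∑ v ∈ searchBox d (2 * scale d k),
      ∑ w ∈ searchBox d (2 * scale d k), ∫ γ, pairTerm i k (-v) (-w) γ ∂(coinMeasure d) := by
  have hexp (γ : Config d) : excess i k γ ^ 2 = ∑ v ∈ searchBox d (2 * scale d k),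
      ∑ w ∈ searchBox d (2 * scale d k), pairTerm i k (-v) (-w) γ := by
    rw [sq, excess, Finset.sum_mul_sum]
    rfl
  have hint (v w : Site d) : Integrable (fun γ => pairTerm i k (-v) (-w) γ) (coinMeasure d) :=
    (isLocal_pairTerm i k _ _).integrable
  simp only [hexp]
  rw [integral_finsetSum _ fun v _ => integrable_finsetSum _ fun w _ => hint v w]
  exact Finset.sum_congr rfl fun v _ => integral_finsetSum _ fun w _ => hint v w

/-- The bound does not depend on `k`. The factor `2` comes from the two orders of a pair of sites on
a line. -/
theorem integral_excess_sq_le (i : Fin d) (k : ℕ) :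
    ∫ γ, excess i k γ ^ 2 ∂(coinMeasure d) ≤ 2 * meanRun i := by
  obtain ⟨N, hN⟩ := exists_gt (2 * scale d k)
  have h := sum_stepProb_le i k N
  have h' : ∑ v ∈ searchBox d (2 * scale d k), ∑ w ∈ searchBox d (2 * scale d k),
      ∑ n ∈ Finset.range N, stepProb i k w v n ≤ meanRun i := by
    rw [Finset.sum_comm]
    exact h
  have hle := Finset.sum_le_sum fun v hv => Finset.sum_le_sum fun w hw =>
    integral_pairTerm_le i hN (v := v) (w := w) hv hw
  rw [← integral_excess_sq_eq] at hle
  simp only [Finset.sum_add_distrib] at hle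
  linarith

/-! ### The density of unmatched sites -/

/-- A root is a marker or has no marker in its search box. The first has probability `8 ^ (-m)`, and
`scale` is large enough that the second is no likelier. -/
theorem measure_exists_root_le (hd : 1 ≤ d) (i : Fin d) (k : ℕ) :
    (coinMeasure d).real {γ | ∃ v ∈ searchBox d (2 * scale d (k + 1)),
      root i (k + 1) γ (-v) = 0} ≤ 2 * (1 / 8 : ℝ) ^ (d * (k + 1)) := by
  set m := d * (k + 1) with hm
  have hm1 : 1 ≤ m := Nat.mul_pos hd (by omega)
  have hpow : ((1 / 8 : ENNReal) ^ m).toReal = (1 / 8 : ℝ) ^ m := by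
    rw [ENNReal.toReal_pow, ENNReal.toReal_div]; norm_num
  have hle1 : (1 / 8 : ENNReal) ^ m ≤ 1 := pow_le_one₀ (by simp) (by simp)
  have h1 : (coinMeasure d).real {γ | IsMarker i m γ 0} = (1 / 8 : ℝ) ^ m := by
    rw [measureReal_def, measure_isMarker, hpow]
  have h2 : (coinMeasure d).real {γ | ∀ v ∈ searchBox d (scale d (k + 1)), ¬ IsMarker i m γ v} ≤
      (1 - (1 / 8 : ℝ) ^ m) ^ ((3 * m * 8 ^ (k + 1)) ^ d) := by
    have := ENNReal.toReal_mono (by finiteness) (measure_forall_not_isMarker_le i hm1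
      (n := 3 * m * 8 ^ (k + 1)) (R := scale d (k + 1)) le_rfl)
    rwa [ENNReal.toReal_pow, ENNReal.toReal_sub_of_le hle1 (by simp), hpow, ENNReal.toReal_one]
      at this
  have h3 : (1 - (1 / 8 : ℝ) ^ m) ^ ((3 * m * 8 ^ (k + 1)) ^ d) ≤ (1 / 8 : ℝ) ^ m := by
    have hq0 : (0 : ℝ) ≤ 1 - (1 / 8 : ℝ) ^ m :=
      sub_nonneg.2 (pow_le_one₀ (by norm_num) (by norm_num))
    -- About `8 ^ m` independent trials are needed to find a marker; the extra factor `3 * m` makes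
    -- the failure probability at most `exp (-3 * m) ≤ 8 ^ (-m)`.
    have hN : 3 * m * 8 ^ m ≤ (3 * m * 8 ^ (k + 1)) ^ d := by
      rw [mul_pow, ← pow_mul, mul_comm (k + 1) d, ← hm]
      exact Nat.mul_le_mul_right _ (Nat.le_self_pow (by omega) _)
    have h8 : (8 : ℝ) ≤ Real.exp 3 := by
      have h := Real.add_one_le_exp (1 : ℝ)
      calc (8 : ℝ) = (1 + 1) ^ 3 := by norm_num
        _ ≤ Real.exp 1 ^ 3 := pow_le_pow_left₀ (by norm_num) h 3
        _ = Real.exp 3 := by rw [← Real.exp_nat_mul]; norm_num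
    calc (1 - (1 / 8 : ℝ) ^ m) ^ ((3 * m * 8 ^ (k + 1)) ^ d)
        ≤ (1 - (1 / 8 : ℝ) ^ m) ^ (3 * m * 8 ^ m) :=
          pow_le_pow_of_le_one hq0 (sub_le_self _ (by positivity)) hN
      _ ≤ Real.exp (-(1 / 8 : ℝ) ^ m) ^ (3 * m * 8 ^ m) :=
          pow_le_pow_left₀ hq0 (Real.one_sub_le_exp_neg _) _
      _ = (Real.exp 3)⁻¹ ^ m := by
          rw [← Real.exp_neg, ← Real.exp_nat_mul, ← Real.exp_nat_mul]
          congr 1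
          push_cast
          rw [one_div, inv_pow]
          field_simp
      _ ≤ (1 / 8 : ℝ) ^ m := by
          rw [one_div]
          exact pow_le_pow_left₀ (by positivity) (inv_anti₀ (by norm_num) h8) _
  calc _ ≤ (coinMeasure d).real ({γ | IsMarker i m γ 0} ∪
          {γ | ∀ v ∈ searchBox d (scale d (k + 1)), ¬ IsMarker i m γ v}) := by
        refine measureReal_mono (fun γ h => ?_)
        obtain ⟨v, -, hv⟩ := h
        refine (isMarker_or_of_root_eq hv).imp_right fun h v hv => ?_
        simpa using h v hv
    _ ≤ _ := (measureReal_union_le _ _).trans (by linarith)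

/-- This is Cauchy–Schwarz for the excess and the event that the cell rooted at the origin is
nonempty, outside which the excess vanishes. It is carried out as a weighted inequality of
arithmetic and geometric means. -/
theorem measure_free_le (hd : 1 ≤ d) (i : Fin d) (k : ℕ) :
    (coinMeasure d).real {γ | matching i (k + 1) γ 0 = 0} ≤
      (meanRun i + 1) * √((1 / 8 : ℝ) ^ (d * (k + 1))) := by
  set q := (1 / 8 : ℝ) ^ (d * (k + 1)) with hq
  have hq0 : 0 < q := by positivity
  -- This weight balances a second moment of order `1` against an event of probability of order `q`.
  set t := √q with ht
  have ht0 : 0 < t := Real.sqrt_pos.2 hq0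
  have htt : t * t = q := Real.mul_self_sqrt hq0.le
  set E : Config d → Prop := fun γ => ∃ v ∈ searchBox d (2 * scale d (k + 1)),
      root i (k + 1) γ (-v) = 0 with hE
  have hEloc : IsLocal E := by
    have h := (isLocal_forall_mem (p := fun v γ => ¬ root i (k + 1) γ (-v) = 0)
      (searchBox d (2 * scale d (k + 1)))
      fun v _ => (isLocal_root_eq i (k + 1) (-v) 0).comp_left Not).comp_left Not
    simpa [hE] using h
  have hpt (γ : Config d) : |excess i (k + 1) γ| ≤
      t / 2 * excess i (k + 1) γ ^ 2 + t⁻¹ / 2 * ind (E γ) := by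
    by_cases h : E γ
    · rw [ind_of_true h]
      have h1 : 0 ≤ (t * |excess i (k + 1) γ| - 1) ^ 2 * t⁻¹ := by positivity
      have h2 : (t * |excess i (k + 1) γ| - 1) ^ 2 * t⁻¹ =
          t * |excess i (k + 1) γ| ^ 2 - 2 * |excess i (k + 1) γ| + t⁻¹ := by
        field_simp
        ring
      rw [sq_abs] at h2
      linarith
    · have h0 : excess i (k + 1) γ = 0 := Finset.sum_eq_zero fun v hv => by
        rw [ind_of_false fun h' => h ⟨v, hv, h'⟩, mul_zero]
      rw [ind_of_false h, h0]
      simp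
  have hsq := ((isLocal_excess i (k + 1)).comp_left (· ^ 2)).integrable
  have hEi := (hEloc.comp_left ind).integrable
  rw [measure_free_eq]
  calc ∫ γ, |excess i (k + 1) γ| ∂(coinMeasure d)
      ≤ ∫ γ, (t / 2 * excess i (k + 1) γ ^ 2 + t⁻¹ / 2 * ind (E γ)) ∂(coinMeasure d) :=
        integral_mono ((isLocal_excess i (k + 1)).comp_left abs).integrable
          ((hsq.const_mul _).add (hEi.const_mul _)) hpt
    _ = t / 2 * ∫ γ, excess i (k + 1) γ ^ 2 ∂(coinMeasure d) +
          t⁻¹ / 2 * (coinMeasure d).real {γ | E γ} := by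
        rw [integral_add (hsq.const_mul _) (hEi.const_mul _), integral_const_mul,
          integral_const_mul, integral_ind hEloc]
    _ ≤ t / 2 * (2 * meanRun i) + t⁻¹ / 2 * (2 * q) := by
        have := integral_excess_sq_le i (k + 1)
        have := measure_exists_root_le hd i k
        gcongr
    _ = (meanRun i + 1) * t := by
        rw [← htt]; field_simp

/-! ### The limiting matching rule -/

open Classical in
/-- The partner of `x` is its first partner in the matchings of the successive levels. -/
def rule (i : Fin d) (p : Config d × Site d) : Site d :=
  if h : ∃ k, matching i k p.1 p.2 ≠ p.2 then matching i (Nat.find h) p.1 p.2 else p.2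

theorem matching_add {i : Fin d} {k : ℕ} {γ : Config d} {x : Site d}
    (h : matching i k γ x ≠ x) (j : ℕ) : matching i (k + j) γ x = matching i k γ x := by
  induction j with
  | zero => rfl
  | succ j ih => rw [← add_assoc, matching_succ_of_ne (ih ▸ h), ih]

theorem rule_eq {i : Fin d} {k : ℕ} {γ : Config d} {x : Site d} (h : matching i k γ x ≠ x) :
    rule i (γ, x) = matching i k γ x := by
  classical
  have hex : ∃ k, matching i k γ x ≠ x := ⟨k, h⟩
  have hle : Nat.find hex ≤ k := Nat.find_min' hex h
  rw [rule, dif_pos hex, ← Nat.add_sub_cancel' hle]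
  exact (matching_add (Nat.find_spec hex) _).symm

theorem rule_eq_self {i : Fin d} {γ : Config d} {x : Site d} (h : ∀ k, matching i k γ x = x) :
    rule i (γ, x) = x := by
  rw [rule, dif_neg (by simpa using h)]

/-- Partners never change once assigned, so the event is a countable union of local ones; this gives
measurability. -/
theorem rule_eq_iff {i : Fin d} {γ : Config d} {x y : Site d} (hxy : y ≠ x) :
    rule i (γ, x) = y ↔ ∃ k, matching i k γ x = y := by
  refine ⟨fun h => ?_, fun ⟨k, hk⟩ => ?_⟩
  · by_contra! hne
    by_cases hex : ∃ k, matching i k γ x ≠ x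
    · obtain ⟨k, hk⟩ := hex
      exact hne k ((rule_eq hk).symm.trans h)
    · push Not at hex
      exact hxy (h.symm.trans (rule_eq_self hex))
  · rw [rule_eq (k := k) (by rwa [hk]), hk]

theorem rule_eq_self_iff {i : Fin d} {γ : Config d} {x : Site d} :
    rule i (γ, x) = x ↔ ∀ k, matching i k γ x = x := by
  refine ⟨fun h k => ?_, rule_eq_self⟩
  by_contra hk
  exact hk ((rule_eq hk).symm.trans h)

theorem measurable_rule (i : Fin d) : Measurable (rule i) := by
  refine measurable_from_prod_countable_left fun x => measurable_to_countable' fun y => ?_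
  have hm (k : ℕ) (y : Site d) : MeasurableSet {γ | matching i k γ x = y} :=
    (isLocal_matching_eq i k x y).measurableSet
  by_cases hxy : y = x
  · subst hxy
    have : (fun γ => rule i (γ, y)) ⁻¹' {y} = ⋂ k, {γ | matching i k γ y = y} := by
      ext γ; simp [rule_eq_self_iff]
    rw [this]
    exact MeasurableSet.iInter fun k => hm k y
  · have : (fun γ => rule i (γ, x)) ⁻¹' {y} = ⋃ k, {γ | matching i k γ x = y} := by
      ext γ; simp [rule_eq_iff hxy]
    rw [this]
    exact MeasurableSet.iUnion fun k => hm k y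

theorem rule_translate (i : Fin d) (γ : Config d) (z x : Site d) :
    rule i (translate z γ, x + z) = rule i (γ, x) + z := by
  by_cases h : ∃ k, matching i k γ x ≠ x
  · obtain ⟨k, hk⟩ := h
    rw [rule_eq hk, rule_eq (k := k) (by rw [matching_translate]; simpa using hk),
      matching_translate]
  · push Not at h
    rw [rule_eq_self h, rule_eq_self fun k => by rw [matching_translate, h]]

theorem measure_forall_matching_zero (hd : 1 ≤ d) (i : Fin d) :
    coinMeasure d {γ | ∀ k, matching i k γ 0 = 0} = 0 := by
  have hlim : Filter.Tendsto (fun k : ℕ => (meanRun i + 1) * √((1 / 8 : ℝ) ^ (d * (k + 1))))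
      Filter.atTop (nhds 0) := by
    have h1 : Filter.Tendsto (fun k : ℕ => d * (k + 1)) Filter.atTop Filter.atTop :=
      Filter.tendsto_atTop_mono (fun k => (Nat.le_succ k).trans (Nat.le_mul_of_pos_left _ hd))
        Filter.tendsto_id
    have h2 := (tendsto_pow_atTop_nhds_zero_of_lt_one (r := (1 / 8 : ℝ)) (by norm_num)
      (by norm_num)).comp h1
    have h3 := (Real.continuous_sqrt.tendsto 0).comp h2
    rw [Real.sqrt_zero] at h3
    simpa using h3.const_mul (meanRun i + 1)
  have hsub (k : ℕ) : {γ : Config d | ∀ k, matching i k γ 0 = 0} ⊆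
      {γ | matching i (k + 1) γ 0 = 0} := fun γ h => h (k + 1)
  have h0 : (coinMeasure d).real {γ | ∀ k, matching i k γ 0 = 0} ≤ 0 :=
    ge_of_tendsto' hlim fun k => (measureReal_mono (hsub k)).trans (measure_free_le hd i k)
  exact (measureReal_eq_zero_iff).1 (le_antisymm h0 measureReal_nonneg)

theorem ae_exists_matching_ne (hd : 1 ≤ d) (i : Fin d) :
    ∀ᵐ γ ∂(coinMeasure d), ∀ x, ∃ k, matching i k γ x ≠ x := by
  rw [ae_all_iff]
  intro x
  have hm : MeasurableSet {γ | ∀ k, matching i k γ x = x} := by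
    rw [Set.ofPred_forall]
    exact MeasurableSet.iInter fun k => (isLocal_matching_eq i k x x).measurableSet
  have h := measure_translate (p := fun γ => ∀ k, matching i k γ x = x)
    (q := fun γ => ∀ k, matching i k γ 0 = 0) x hm fun γ => forall_congr' fun k => by
      have := matching_translate i k γ x 0
      rw [zero_add] at this
      rw [this, add_eq_right]
  rw [measure_forall_matching_zero hd i] at h
  rw [ae_iff]
  simpa using h

theorem isMatchingRule_rule (hd : 1 ≤ d) (i : Fin d) : IsMatchingRule (rule i) := by
  refine ⟨measurable_rule i, (ae_exists_matching_ne hd i).mono fun γ h => ?_⟩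
  have hinv (x : Site d) : rule i (γ, rule i (γ, x)) = x := by
    obtain ⟨k, hk⟩ := h x
    have hM := isMaximalMatching_matching i k γ
    rw [rule_eq hk, rule_eq (k := k) (by rw [hM.involutive]; exact hk.symm), hM.involutive]
  have hne (x : Site d) : γ (rule i (γ, x)) ≠ γ x := by
    obtain ⟨k, hk⟩ := h x
    rw [rule_eq hk]
    exact (isMaximalMatching_matching i k γ).coin_ne x hk
  exact ⟨Function.Involutive.bijective hinv, fun x hx => by simpa [hx] using hne x,
    fun x hx => by simpa [hx] using hne x, hinv⟩

/-- The origin and its partner have the same root, and both offsets to it lie in the same box. -/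
theorem norm_matching_le (i : Fin d) (k : ℕ) (γ : Config d) :
    ‖matching i k γ 0‖ ≤ (2 * scale d k : ℕ) := by
  refine (pi_norm_le_iff_of_nonneg (by positivity)).2 fun j => ?_
  have h1 := mem_searchBox.1 (root_sub_mem i k γ 0) j
  have h2 := mem_searchBox.1 (root_sub_mem i k γ (matching i k γ 0)) j
  rw [(isMaximalMatching_matching i k γ).root_eq] at h2
  simp only [Pi.sub_apply, Pi.zero_apply] at h1 h2
  have h3 : |matching i k γ 0 j| ≤ (2 * scale d k : ℕ) := by
    rw [abs_le]; omega
  rw [Int.norm_eq_abs]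
  exact_mod_cast h3

theorem measure_lt_partnerDist_le (hd : 1 ≤ d) (i : Fin d) {k : ℕ} (hk : 1 ≤ k) {r : ℝ}
    (hr : (2 * scale d k : ℕ) ≤ r) :
    (coinMeasure d).real {γ | r < partnerDist (rule i) γ} ≤
      (meanRun i + 1) * √((1 / 8 : ℝ) ^ (d * k)) := by
  obtain ⟨k, rfl⟩ := Nat.exists_eq_add_of_le' hk
  refine (measureReal_mono fun γ hγ => ?_).trans (measure_free_le hd i k)
  by_contra hne
  have h1 : r < ‖rule i (γ, 0)‖ := hγ
  rw [rule_eq hne] at h1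
  exact absurd (norm_matching_le i (k + 1) γ) (not_le.2 (hr.trans_lt h1))

/-- For all large `r` there is a level with cells of diameter at most `r` whose density of
unmatched sites has the required order. -/
theorem eventually_exists_level (hd : 1 ≤ d) : ∀ᶠ r : ℝ in Filter.atTop, ∃ k : ℕ, 1 ≤ k ∧
    ((2 * scale d k : ℕ) : ℝ) ≤ r ∧
    √((1 / 8 : ℝ) ^ (d * k)) ≤ 8 ^ ((d : ℝ) / 2) * r ^ (-(2 * (d : ℝ) / ((d : ℝ) + 4))) := by
  have hd0 : (0 : ℝ) < d := by exact_mod_cast hd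
  -- Chosen so that `a * d / 2 = 2 * d / (d + 4)`. As `a < 1`, the power `r ^ (1 - a)` dominates the
  -- squared logarithm in the cell diameter.
  set a : ℝ := 4 / (d + 4) with ha
  have ha0 : 0 < a := by positivity
  have ha1 : a < 1 := by rw [ha, div_lt_one (by positivity)]; linarith
  have hlog8 : 1 ≤ Real.log 8 := by
    rw [Real.le_log_iff_exp_le (by norm_num)]
    linarith [Real.exp_one_lt_d9]
  have h1 : ∀ᶠ r : ℝ in Filter.atTop, 30 * (d : ℝ) ^ 2 * Real.log r ^ (2 : ℝ) ≤ r ^ (1 - a) := by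
    have h := (isLittleO_log_rpow_rpow_atTop 2 (sub_pos.2 ha1)).bound
      (c := 1 / (30 * (d : ℝ) ^ 2)) (by positivity)
    filter_upwards [h, Filter.eventually_ge_atTop 1] with r hr hr1
    have hl : 0 ≤ Real.log r := Real.log_nonneg hr1
    rw [Real.norm_of_nonneg (by positivity), Real.norm_of_nonneg (by positivity)] at hr
    calc 30 * (d : ℝ) ^ 2 * Real.log r ^ (2 : ℝ)
        ≤ 30 * (d : ℝ) ^ 2 * (1 / (30 * (d : ℝ) ^ 2) * r ^ (1 - a)) := by gcongr
      _ = r ^ (1 - a) := by field_simp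
  filter_upwards [h1, Filter.eventually_ge_atTop (8 ^ (1 / a) : ℝ), Filter.eventually_ge_atTop 1]
    with r hr hr8 hr1
  have hr0 : 0 < r := by linarith
  have h8 : (8 : ℝ) ≤ r ^ a := by
    calc (8 : ℝ) = (8 ^ (1 / a)) ^ a := by
          rw [← Real.rpow_mul (by norm_num), one_div_mul_cancel ha0.ne', Real.rpow_one]
      _ ≤ r ^ a := Real.rpow_le_rpow (by positivity) hr8 ha0.le
  -- The level satisfies `8 ^ k ≤ r ^ a < 8 ^ (k + 1)`: the left side controls the diameter, the
  -- right side the density.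
  obtain ⟨k, hk1, hk2⟩ := exists_nat_pow_near (x := r ^ a) (y := (8 : ℝ)) (by linarith)
    (by norm_num)
  have hk : 1 ≤ k := by
    by_contra! h
    interval_cases k
    norm_num at hk2
    linarith
  refine ⟨k, hk, ?_, ?_⟩
  · have hkl : (k : ℝ) ≤ Real.log r := by
      have h2 : k * Real.log 8 ≤ a * Real.log r := by
        rw [← Real.log_pow, ← Real.log_rpow hr0]
        exact Real.log_le_log (by positivity) hk1
      nlinarith [Real.log_nonneg hr1, (k.cast_nonneg : (0 : ℝ) ≤ k)]
    calc ((2 * scale d k : ℕ) : ℝ) = 30 * (d : ℝ) ^ 2 * (k : ℝ) ^ 2 * 8 ^ k := by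
          unfold scale; push_cast; ring
      _ ≤ 30 * (d : ℝ) ^ 2 * Real.log r ^ 2 * r ^ a := by gcongr
      _ ≤ r ^ (1 - a) * r ^ a := by
          rw [← Real.rpow_natCast (Real.log r) 2]
          gcongr
          exact_mod_cast hr
      _ = r := by rw [← Real.rpow_add hr0, sub_add_cancel, Real.rpow_one]
  · have h3 : ((1 / 8 : ℝ) ^ k) ≤ 8 * r ^ (-a) := by
      rw [Real.rpow_neg hr0.le, one_div, inv_pow, ← div_eq_mul_inv,
        le_div_iff₀ (by positivity), inv_mul_le_iff₀ (by positivity)]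
      rw [pow_succ] at hk2
      exact hk2.le
    calc √((1 / 8 : ℝ) ^ (d * k)) = ((1 / 8 : ℝ) ^ k) ^ ((d : ℝ) / 2) := by
          rw [mul_comm, pow_mul, Real.sqrt_eq_rpow, ← Real.rpow_natCast _ d,
            ← Real.rpow_mul (by positivity)]
          congr 1
          ring
      _ ≤ (8 * r ^ (-a)) ^ ((d : ℝ) / 2) := Real.rpow_le_rpow (by positivity) h3 (by positivity)
      _ = 8 ^ ((d : ℝ) / 2) * r ^ (-(2 * (d : ℝ) / ((d : ℝ) + 4))) := by
          rw [Real.mul_rpow (by norm_num) (by positivity), ← Real.rpow_mul hr0.le]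
          congr 2
          rw [ha]
          field_simp
          ring

theorem exists_tail_bound (hd : 1 ≤ d) (i : Fin d) : ∃ C : ℝ, 0 ≤ C ∧ ∀ r : ℝ, 1 ≤ r →
    (coinMeasure d).real {γ | r < partnerDist (rule i) γ} ≤
      C * r ^ (-(2 * (d : ℝ) / ((d : ℝ) + 4))) := by
  obtain ⟨r₀, hr₀⟩ := Filter.eventually_atTop.1 (eventually_exists_level hd)
  set β : ℝ := 2 * (d : ℝ) / ((d : ℝ) + 4) with hβ
  have hβ0 : 0 ≤ β := by positivity
  have hm : 0 ≤ meanRun i := tsum_nonneg fun _ => measureReal_nonneg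
  set C₁ := (meanRun i + 1) * 8 ^ ((d : ℝ) / 2)
  have hC₁ : 0 ≤ C₁ := by positivity
  -- The second summand makes the bound at least `1`, hence trivial, for `r < r₀`.
  refine ⟨C₁ + |r₀| ^ β, by positivity, fun r hr => ?_⟩
  have hr0 : 0 < r := by linarith
  rw [add_mul]
  by_cases h : r₀ ≤ r
  · obtain ⟨k, hk, hk1, hk2⟩ := hr₀ r h
    calc _ ≤ (meanRun i + 1) * √((1 / 8 : ℝ) ^ (d * k)) := measure_lt_partnerDist_le hd i hk hk1
      _ ≤ (meanRun i + 1) * (8 ^ ((d : ℝ) / 2) * r ^ (-β)) := by gcongr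
      _ = C₁ * r ^ (-β) := (mul_assoc _ _ _).symm
      _ ≤ _ := le_add_of_nonneg_right (by positivity)
  · push Not at h
    calc _ ≤ (1 : ℝ) := measureReal_le_one
      _ = r ^ β * r ^ (-β) := by rw [← Real.rpow_add hr0, add_neg_cancel, Real.rpow_zero]
      _ ≤ |r₀| ^ β * r ^ (-β) := by
          gcongr
          exact h.le.trans (le_abs_self _)
      _ ≤ _ := le_add_of_nonneg_left (by positivity)

/-! ### Moments -/

theorem lintegral_rpow_lt_top_of_tail {Ω : Type*} [MeasurableSpace Ω] (μ : Measure Ω)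
    [IsProbabilityMeasure μ] {Z : Ω → ℝ} (hZ : Measurable Z) (hZ0 : ∀ ω, 0 ≤ Z ω) {C β s : ℝ}
    (hs : 0 < s) (hsβ : s < β)
    (h : ∀ r : ℝ, 1 ≤ r → μ.real {ω | r < Z ω} ≤ C * r ^ (-β)) :
    ∫⁻ ω, ENNReal.ofReal (Z ω ^ s) ∂μ < ⊤ := by
  rw [lintegral_rpow_eq_lintegral_meas_lt_mul μ (Filter.Eventually.of_forall hZ0)
    hZ.aemeasurable hs]
  refine ENNReal.mul_lt_top ENNReal.ofReal_lt_top ?_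
  -- In the layer-cake integral, `0 < s` gives convergence near `0` and `s < β` gives it at
  -- infinity.
  rw [← Set.Ioc_union_Ioi_eq_Ioi zero_le_one]
  refine (lintegral_union_le _ _ _).trans_lt (ENNReal.add_lt_top.2 ⟨?_, ?_⟩)
  · have hint : IntegrableOn (fun t : ℝ => t ^ (s - 1)) (Set.Ioc 0 1) :=
      (intervalIntegrable_iff_integrableOn_Ioc_of_le zero_le_one).1
        (intervalIntegral.intervalIntegrable_rpow' (by linarith))
    refine lt_of_le_of_lt (lintegral_mono fun t => ?_) hint.lintegral_lt_top
    exact mul_le_of_le_one_left (by simp) prob_le_one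
  · have hint : IntegrableOn (fun t : ℝ => C * t ^ (-β + (s - 1))) (Set.Ioi 1) :=
      (integrableOn_Ioi_rpow_of_lt (by linarith) zero_lt_one).const_mul C
    refine lt_of_le_of_lt (setLIntegral_mono' measurableSet_Ioi fun t ht => ?_)
      hint.lintegral_lt_top
    have ht0 : 0 < t := zero_lt_one.trans ht
    rw [← ofReal_measureReal, ← ENNReal.ofReal_mul measureReal_nonneg]
    refine ENNReal.ofReal_le_ofReal ?_
    rw [Real.rpow_add ht0, ← mul_assoc]
    exact mul_le_mul_of_nonneg_right (h t (le_of_lt ht)) (by positivity)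

theorem measurable_partnerDist (i : Fin d) : Measurable (partnerDist (rule i)) :=
  measurable_norm.comp ((measurable_rule i).comp (measurable_id.prodMk measurable_const))

theorem partnerDist_eq_zero_or_one_le (Φ : Config d × Site d → Site d) (γ : Config d) :
    partnerDist Φ γ = 0 ∨ 1 ≤ partnerDist Φ γ := by
  by_cases h : Φ (γ, 0) = 0
  · exact Or.inl (by rw [partnerDist, h, norm_zero])
  · obtain ⟨j, hj⟩ := Function.ne_iff.1 h
    refine Or.inr (le_trans ?_ (norm_le_pi_norm (Φ (γ, 0)) j))
    rw [Int.norm_eq_abs]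
    exact_mod_cast Int.one_le_abs hj

theorem lintegral_partnerDist_rpow_lt_top (hd : 2 ≤ d) (i : Fin d) {ε : ℝ} (hε : 0 < ε) :
    ∫⁻ γ, ENNReal.ofReal (partnerDist (rule i) γ ^ (2 / 3 - ε)) ∂(coinMeasure d) < ⊤ := by
  -- For a nonpositive exponent the integrand is at most `1`, because the distance takes no value
  -- strictly between `0` and `1` and `0 ^ s ≤ 1` by convention.
  rcases le_or_gt (2 / 3 - ε) 0 with hs | hs
  · calc _ ≤ ∫⁻ _, 1 ∂(coinMeasure d) := lintegral_mono fun γ => ?_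
      _ < ⊤ := by simp
    rw [ENNReal.ofReal_le_one]
    rcases partnerDist_eq_zero_or_one_le (rule i) γ with h | h
    · rw [h]
      exact Real.zero_rpow_le_one _
    · exact Real.rpow_le_one_of_one_le_of_nonpos h hs
  · obtain ⟨C, -, h⟩ := exists_tail_bound (by omega : 1 ≤ d) i
    refine lintegral_rpow_lt_top_of_tail _ (measurable_partnerDist i) (fun _ => norm_nonneg _) hs
      ?_ h
    have hd' : (2 : ℝ) ≤ d := by exact_mod_cast hd
    calc 2 / 3 - ε < 2 / 3 := by linarith
      -- Equality holds for `d = 2`, and the right side increases with `d`.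
      _ ≤ 2 * (d : ℝ) / (d + 4) := by
        rw [div_le_div_iff₀ (by norm_num) (by positivity)]; linarith

end CoinMatching

end

theorem theorem1 (d : ℕ) (hd : 1 ≤ d) :
    ∃ Φ : CoinMatching.Config d × CoinMatching.Site d → CoinMatching.Site d,
      CoinMatching.IsMatchingRule Φ ∧ CoinMatching.IsTranslationEquivariant Φ ∧
      (∃ c : ℝ, ∀ r : ℝ, 2 ≤ r →
        (CoinMatching.coinMeasure d).real {γ | r < CoinMatching.partnerDist Φ γ} ≤
          c * Real.log r ^ 4 * r ^ (-(2 * (d : ℝ) / ((d : ℝ) + 4)))) ∧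
      (2 ≤ d → ∀ ε : ℝ, 0 < ε →
        ∫⁻ γ, ENNReal.ofReal (CoinMatching.partnerDist Φ γ ^ (2 / 3 - ε))
          ∂(CoinMatching.coinMeasure d) < ⊤) := by
  have i : Fin d := ⟨0, hd⟩
  refine ⟨CoinMatching.rule i, CoinMatching.isMatchingRule_rule hd i,
    Filter.Eventually.of_forall fun γ z x => CoinMatching.rule_translate i γ z x, ?_,
    fun hd2 ε hε => CoinMatching.lintegral_partnerDist_rpow_lt_top hd2 i hε⟩
  obtain ⟨C, hC, h⟩ := CoinMatching.exists_tail_bound hd i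
  have hlog2 : 0 < Real.log 2 := Real.log_pos (by norm_num)
  -- The tail bound holds without logarithms; for `r ≥ 2` the factor `(log r / log 2) ^ 4` is at
  -- least `1` and can be inserted.
  refine ⟨C / Real.log 2 ^ 4, fun r hr => (h r (by linarith)).trans ?_⟩
  refine mul_le_mul_of_nonneg_right ?_ (by positivity)
  rw [div_mul_eq_mul_div, le_div_iff₀ (by positivity)]
  exact mul_le_mul_of_nonneg_left
    (pow_le_pow_left₀ hlog2.le (Real.log_le_log (by norm_num) hr) 4) hC
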